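/- Let $1<p<\infty$ and $d\ge 2$, let $\Omega\subset\mathbb{R}^d$ be a bounded domain (a nonempty, connected, open set), and let $D\subset\Omega$ be an open set with Lipschitz boundary. Let $\sigma=1+\sigma_D\chi_D$ be measurable, where $\chi_D$ is the characteristic function of $D$ and either $c\le\sigma_D\le C$ on $D$, or $-1+c\le\sigma_D\le -c$ on $D$, for some constants $c>0$ and $C$. Put $X=W^{1,p}(\Omega)/W^{1,p}_0(\Omega)$ and, for a conductivity $\gamma$, let the weak Dirichlet-to-Neumann (DN) map $\Lambda_\gamma\colon X\to X'$ be given by $$\langle\Lambda_\gamma f,g\rangle=\int_\Omega\gamma|\nabla u|^{p-2}\nabla u\cdot\nabla v\,dx,$$ where $u\in W^{1,p}(\Omega)$ is a minimizer of $\int_\Omega\gamma|\nabla u|^p\,dx$ among the functions with boundary values $f$, and $v\in W^{1,p}(\Omega)$ is any function with boundary values $g$. Then $\Lambda_\sigma$ and $\Lambda_1$ are well defined, and the convex hull of $D$ and (if $D\neq\emptyset$) the sign of $\sigma_D$ can be recovered from $\Lambda_\sigma$, by the enclosure method with Wolff solutions. In detail, there are functions $w\in C^\infty(\mathbb{R})$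 with $(w(0),w'(0))\ne(0,0)$ and $$w''+V(w,w')\,w=0,\qquad V(a,b)=\frac{(2p-3)b^2+(p-1)a^2}{(p-1)b^2+a^2}.$$ Take any such $w$ and, for orthogonal unit vectors $\rho,\rho^\perp\in\mathbb{R}^d$, $t\in\mathbb{R}$ and $\tau>0$, put $$I(t,\rho,\rho^\perp,\tau)=\tau^{d-p}\langle\Lambda_\sigma f-\Lambda_1 f,f\rangle,$$ where $f\in X$ is the boundary value of $x\mapsto e^{\tau(\rho\cdot x-t)}w(\tau\rho^\perp\cdot x)$. Then: 1. The convex hull of $D$ is the interior of the intersection of all half-spaces $\{x:\rho\cdot x\le t\}$ for which $I(t,\rho,\rho^\perp,\tau)\to 0$ as $\tau\to\infty$ for some unit vector $\rho^\perp$ orthogonal to $\rho$. 2. If $D\ne\emptyset$, then for all $t,\rho,\rho^\perp$ and all $\tau>0$: $\sigma_D>0$ on $D$ if and only if $I(t,\rho,\rho^\perp,\tau)>0$, and $\sigma_D<0$ on $D$ if and only if $I(t,\rho,\rho^\perp,\tau)<0$. -/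

import Mathlib

open MeasureTheory Filter Topology
open scoped ENNReal NNReal ContDiff

noncomputable section

namespace PCalderon

/-- Euclidean space `ℝ^d`. -/
abbrev Space (d : ℕ) : Type := EuclideanSpace ℝ (Fin d)

/-- Test functions: `φ ∈ C_c^∞(Ω)`. -/
structure IsTestFunction {d : ℕ} (Ω : Set (Space d)) (φ : Space d → ℝ) : Prop where
  smooth : ContDiff ℝ ∞ φ
  compact : HasCompactSupport φ
  support : tsupport φ ⊆ Ω

/-- `G` is the weak (distributional) gradient of `u` in `Ω`: for every test function `φ` and
every direction `e`, `∫_Ω u ∂_e φ = - ∫_Ω φ (G · e)`. -/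
def HasWeakGradient {d : ℕ} (Ω : Set (Space d)) (u : Space d → ℝ) (G : Space d → Space d) :
    Prop :=
  ∀ φ : Space d → ℝ, IsTestFunction Ω φ → ∀ e : Space d,
    ∫ x in Ω, fderiv ℝ φ x e * u x = - ∫ x in Ω, φ x * inner ℝ (G x) e

theorem integrable_fderiv_mul {d : ℕ} {p : ℝ≥0∞} [Fact (1 ≤ p)] {Ω : Set (Space d)}
    {φ : Space d → ℝ} (hφ : IsTestFunction Ω φ) (e : Space d)
    (u : Lp ℝ p (volume.restrict Ω)) :
    Integrable (fun x => fderiv ℝ φ x e * u x) (volume.restrict Ω) := by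
  have h1 : LocallyIntegrable (u : Space d → ℝ) (volume.restrict Ω) :=
    (Lp.memLp u).locallyIntegrable Fact.out
  have h2 : Continuous (fun x => fderiv ℝ φ x e) :=
    (hφ.smooth.continuous_fderiv (by simp)).clm_apply continuous_const
  have h3 : HasCompactSupport (fun x => fderiv ℝ φ x e) := hφ.compact.fderiv_apply ℝ e
  exact h1.integrable_smul_left_of_hasCompactSupport h2 h3

theorem integrable_mul_inner {d : ℕ} {p : ℝ≥0∞} [Fact (1 ≤ p)] {Ω : Set (Space d)}
    {φ : Space d → ℝ} (hφ : IsTestFunction Ω φ) (e : Space d)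
    (G : Lp (Space d) p (volume.restrict Ω)) :
    Integrable (fun x => φ x * inner ℝ (G x) e) (volume.restrict Ω) := by
  have h1 : LocallyIntegrable (G : Space d → Space d) (volume.restrict Ω) :=
    (Lp.memLp G).locallyIntegrable Fact.out
  have h2 := h1.integrable_smul_left_of_hasCompactSupport hφ.smooth.continuous hφ.compact
  have h3 := h2.inner_const (𝕜 := ℝ) e
  simpa [real_inner_smul_left] using h3

/-- The Sobolev space `W^{1,p}(Ω)`: the pairs `(u, ∇u)` in `L^p(Ω) × L^p(Ω; ℝ^d)` where the second
component is the weak gradient of the first one. As a subspace of the product it carries (a norm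
equivalent to) the usual Sobolev norm. -/
def sobolev {d : ℕ} (p : ℝ≥0∞) [Fact (1 ≤ p)] (Ω : Set (Space d)) :
    Submodule ℝ (Lp ℝ p (volume.restrict Ω) × Lp (Space d) p (volume.restrict Ω)) where
  carrier := {f | HasWeakGradient Ω f.1 f.2}
  zero_mem' := by
    intro φ hφ e
    have h1 : ∫ x in Ω, fderiv ℝ φ x e * (0 : Lp ℝ p (volume.restrict Ω)) x = ∫ x in Ω, 0 := by
      refine integral_congr_ae ?_
      filter_upwards [Lp.coeFn_zero ℝ p (volume.restrict Ω)] with x hx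
      rw [hx]
      simp
    have h2 : ∫ x in Ω, φ x * inner ℝ ((0 : Lp (Space d) p (volume.restrict Ω)) x) e
        = ∫ x in Ω, 0 := by
      refine integral_congr_ae ?_
      filter_upwards [Lp.coeFn_zero (Space d) p (volume.restrict Ω)] with x hx
      rw [hx]
      simp
    simp only [Prod.fst_zero, Prod.snd_zero]
    rw [h1, h2]
    simp
  add_mem' := by
    intro f g hf hg φ hφ e
    have h1 : ∫ x in Ω, fderiv ℝ φ x e * (f.1 + g.1 : Lp ℝ p (volume.restrict Ω)) x
        = (∫ x in Ω, fderiv ℝ φ x e * f.1 x) + ∫ x in Ω, fderiv ℝ φ x e * g.1 x := by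
      rw [← integral_add (integrable_fderiv_mul hφ e f.1) (integrable_fderiv_mul hφ e g.1)]
      refine integral_congr_ae ?_
      filter_upwards [Lp.coeFn_add f.1 g.1] with x hx
      rw [hx, Pi.add_apply, mul_add]
    have h2 : ∫ x in Ω, φ x * inner ℝ ((f.2 + g.2 : Lp (Space d) p (volume.restrict Ω)) x) e
        = (∫ x in Ω, φ x * inner ℝ (f.2 x) e) + ∫ x in Ω, φ x * inner ℝ (g.2 x) e := by
      rw [← integral_add (integrable_mul_inner hφ e f.2) (integrable_mul_inner hφ e g.2)]
      refine integral_congr_ae ?_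
      filter_upwards [Lp.coeFn_add f.2 g.2] with x hx
      rw [hx, Pi.add_apply, inner_add_left, mul_add]
    simp only [Prod.fst_add, Prod.snd_add]
    rw [h1, h2, hf φ hφ e, hg φ hφ e]
    ring
  smul_mem' := by
    intro c f hf φ hφ e
    have h1 : ∫ x in Ω, fderiv ℝ φ x e * (c • f.1 : Lp ℝ p (volume.restrict Ω)) x
        = c * ∫ x in Ω, fderiv ℝ φ x e * f.1 x := by
      rw [← integral_const_mul]
      refine integral_congr_ae ?_
      filter_upwards [Lp.coeFn_smul c f.1] with x hx
      simp only [hx, Pi.smul_apply, smul_eq_mul]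
      ring
    have h2 : ∫ x in Ω, φ x * inner ℝ ((c • f.2 : Lp (Space d) p (volume.restrict Ω)) x) e
        = c * ∫ x in Ω, φ x * inner ℝ (f.2 x) e := by
      rw [← integral_const_mul]
      refine integral_congr_ae ?_
      filter_upwards [Lp.coeFn_smul c f.2] with x hx
      simp only [hx, Pi.smul_apply, real_inner_smul_left]
      ring
    simp only [Prod.smul_fst, Prod.smul_snd]
    rw [h1, h2, hf φ hφ e]
    ring

section Sobolev

variable {d : ℕ} {p : ℝ≥0∞} [Fact (1 ≤ p)] {Ω : Set (Space d)}

/-- The function underlying an element of `W^{1,p}(Ω)`. -/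
def toFun (u : sobolev p Ω) : Lp ℝ p (volume.restrict Ω) := u.1.1

/-- The weak gradient of an element of `W^{1,p}(Ω)`. -/
def grad (u : sobolev p Ω) : Lp (Space d) p (volume.restrict Ω) := u.1.2

end Sobolev

/-- `W^{1,p}_0(Ω)`: the closure of the test functions in `W^{1,p}(Ω)`. -/
def sobolevZero {d : ℕ} (p : ℝ≥0∞) [Fact (1 ≤ p)] (Ω : Set (Space d)) :
    Submodule ℝ (sobolev p Ω) :=
  (Submodule.span ℝ {u : sobolev p Ω |
    ∃ φ, IsTestFunction Ω φ ∧ toFun u =ᵐ[volume.restrict Ω] φ}).topologicalClosure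

/-- The space of boundary values `X = W^{1,p}(Ω) / W^{1,p}_0(Ω)`. -/
abbrev BoundaryValues {d : ℕ} (p : ℝ≥0∞) [Fact (1 ≤ p)] (Ω : Set (Space d)) : Type :=
  sobolev p Ω ⧸ sobolevZero p Ω

/-- The boundary values of an element of `W^{1,p}(Ω)`. -/
def trace {d : ℕ} {p : ℝ≥0∞} [Fact (1 ≤ p)] {Ω : Set (Space d)} (u : sobolev p Ω) :
    BoundaryValues p Ω :=
  (sobolevZero p Ω).mkQ u

open Classical in
/-- The boundary values of a function `f` whose restriction to `Ω` is in `W^{1,p}(Ω)`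
(and zero for other functions). -/
def traceOf {d : ℕ} (p : ℝ≥0∞) [Fact (1 ≤ p)] (Ω : Set (Space d)) (f : Space d → ℝ) :
    BoundaryValues p Ω :=
  if h : ∃ u : sobolev p Ω, toFun u =ᵐ[volume.restrict Ω] f then trace h.choose else 0

section Forward

variable {d : ℕ} {p : ℝ≥0∞} [Fact (1 ≤ p)] {Ω : Set (Space d)}

/-- The energy `E(u) = ∫_Ω σ |∇u|^p`. -/
def energy (σ : Space d → ℝ) (u : sobolev p Ω) : ℝ :=
  ∫ x in Ω, σ x * ‖grad u x‖ ^ p.toReal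

/-- `u` minimizes the energy among all functions in `u + W^{1,p}_0(Ω)`. -/
def IsMinimizer (σ : Space d → ℝ) (u : sobolev p Ω) : Prop :=
  ∀ v : sobolev p Ω, trace v = trace u → energy σ u ≤ energy σ v

/-- The pairing `∫_Ω σ |∇u|^{p-2} ∇u · ∇v`. -/
def fluxPairing (σ : Space d → ℝ) (u v : sobolev p Ω) : ℝ :=
  ∫ x in Ω, σ x * ‖grad u x‖ ^ (p.toReal - 2) * inner ℝ (grad u x) (grad v x)

/-- `Λ : X → X'` is the weak Dirichlet-to-Neumann map of the conductivity `σ`: every boundary value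
has an energy minimizer, and `⟨Λ f, g⟩ = ∫_Ω σ |∇u|^{p-2} ∇u · ∇v` whenever `u` is a
minimizer with boundary values `f` and `v ∈ W^{1,p}(Ω)` has boundary values `g`. These
properties determine `Λ`. -/
structure IsDNMap (σ : Space d → ℝ)
    (Λ : BoundaryValues p Ω → StrongDual ℝ (BoundaryValues p Ω)) : Prop where
  exists_minimizer : ∀ f : BoundaryValues p Ω, ∃ u : sobolev p Ω, trace u = f ∧ IsMinimizer σ u
  pairing : ∀ u v : sobolev p Ω, IsMinimizer σ u → Λ (trace u) (trace v) = fluxPairing σ u v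

end Forward

open Classical in
/-- The Dirichlet-to-Neumann map `Λ_σ : X → X'` (zero for those `σ` for which there is none). -/
def dnMap {d : ℕ} (p : ℝ≥0∞) [Fact (1 ≤ p)] (Ω : Set (Space d)) (σ : Space d → ℝ) :
    BoundaryValues p Ω → StrongDual ℝ (BoundaryValues p Ω) :=
  if h : ∃ Λ : BoundaryValues p Ω → StrongDual ℝ (BoundaryValues p Ω), IsDNMap σ Λ
  then h.choose else 0

/-- An open set has Lipschitz boundary: near each boundary point, it is the region on one side
of the graph of a Lipschitz function over a hyperplane `e^⊥`. -/
def HasLipschitzBoundary {d : ℕ} (D : Set (Space d)) : Prop :=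
  ∀ x ∈ frontier D, ∃ (e : Space d) (r : ℝ) (K : ℝ≥0) (g : (ℝ ∙ e)ᗮ → ℝ),
    ‖e‖ = 1 ∧ 0 < r ∧ LipschitzWith K g ∧
      ∀ y ∈ Metric.ball x r, y ∈ D ↔ g ((ℝ ∙ e)ᗮ.orthogonalProjectionOnto y) < inner ℝ e y

/-- The conductivity `σ = 1 + σ_D χ_D`. -/
def inclusionConductivity {d : ℕ} (D : Set (Space d)) (σD : Space d → ℝ) : Space d → ℝ :=
  fun x => 1 + D.indicator σD x

/-- `V(a, b) = ((2p-3) b² + (p-1) a²) / ((p-1) b² + a²)`. -/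
def wolffV (p a b : ℝ) : ℝ :=
  ((2 * p - 3) * b ^ 2 + (p - 1) * a ^ 2) / ((p - 1) * b ^ 2 + a ^ 2)

/-- `w` is a Wolff function: a smooth solution of `w'' + V(w, w') w = 0` with
`(w(0), w'(0)) ≠ (0, 0)`. -/
structure IsWolffFunction (p : ℝ) (w : ℝ → ℝ) : Prop where
  smooth : ContDiff ℝ ∞ w
  ode : ∀ s : ℝ, deriv (deriv w) s + wolffV p (w s) (deriv w s) * w s = 0
  nontrivial : w 0 ≠ 0 ∨ deriv w 0 ≠ 0

/-- The Wolff solution `x ↦ exp(τ (ρ · x - t)) w(τ ρ^⊥ · x)`. -/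
def wolffSolution {d : ℕ} (w : ℝ → ℝ) (t : ℝ) (ρ ρ' : Space d) (τ : ℝ) : Space d → ℝ :=
  fun x => Real.exp (τ * (inner ℝ ρ x - t)) * w (τ * inner ℝ ρ' x)

/-- The indicator function `I(t, ρ, ρ^⊥, τ) = τ^{d-p} ⟨(Λ - Λ_1) f, f⟩`, where `f` is the boundary
value of the Wolff solution. -/
def indicatorFunction {d : ℕ} (p : ℝ≥0∞) [Fact (1 ≤ p)] (Ω : Set (Space d)) (w : ℝ → ℝ)
    (Λ : BoundaryValues p Ω → StrongDual ℝ (BoundaryValues p Ω))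
    (t : ℝ) (ρ ρ' : Space d) (τ : ℝ) : ℝ :=
  τ ^ ((d : ℝ) - p.toReal) *
    (Λ (traceOf p Ω (wolffSolution w t ρ ρ' τ)) -
      dnMap p Ω 1 (traceOf p Ω (wolffSolution w t ρ ρ' τ)))
      (traceOf p Ω (wolffSolution w t ρ ρ' τ))

/-- The set that the enclosure method reads off a boundary map `Λ : X → X'`: the interior of the
intersection of all half-spaces `{x | ρ · x ≤ t}` for which the indicator function
`I(t, ρ, ρ^⊥, τ)` tends to zero as `τ → ∞`. -/
def enclosure {d : ℕ} (p : ℝ≥0∞) [Fact (1 ≤ p)] (Ω : Set (Space d)) (w : ℝ → ℝ)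
    (Λ : BoundaryValues p Ω → StrongDual ℝ (BoundaryValues p Ω)) : Set (Space d) :=
  interior {x | ∀ (ρ ρ' : Space d) (t : ℝ), ‖ρ‖ = 1 → ‖ρ'‖ = 1 → inner ℝ ρ ρ' = 0 →
    Tendsto (fun τ => indicatorFunction p Ω w Λ t ρ ρ' τ) atTop (𝓝 0) → inner ℝ ρ x ≤ t}

end PCalderon

end

/-! Pairing a minimizer with itself gives its energy, so `⟨(Λ_σ - Λ_1) f, f⟩` is the minimal
`σ`-energy minus the minimal background energy. Let `u` be the background minimizer and `P` the real
exponent. Using `u` as a competitor for `σ` bounds the gap above by `∫ (σ - 1) |∇u|^P` (`dnGap_le`).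
The Euler-Lagrange equation for `u` and a Young inequality weighted by `σ(x)` bound it below by `(P
- 1) ∫ (1 - σ^(-1/(P-1))) |∇u|^P` (`le_dnGap`). Both weights vanish off `D`; on `D` they have the
sign of `σ_D` and stay away from zero. So, up to that sign, the gap is comparable with `∫_D |∇u|^P`.

For a Wolff solution, `|∇u|^P = τ^P e^(Pτ(ρ·x - t)) (w² + w'²)^(P/2)`, and a first integral of the
Wolff equation keeps `w² + w'²` between positive constants
(`IsWolffFunction.exists_modulus_bounds`). Hence `±I` is comparable with `τ^d ∫_D e^(Pτ(ρ·x - t))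
dx`. This is positive for nonempty `D`, which yields the sign. It tends to zero if `ρ·x ≤ t - δ` on
`D`, and does not if `ρ·x > t` somewhere on `D`. With strict separation this suffices: the
intersection of the half-spaces lies between `D` and the closed convex hull, so the case where `D`
just touches the half-space boundary never has to be decided. As the hull is open, taking the
interior returns exactly it (`enclosure_eq_convexHull`).

The Dirichlet-to-Neumann maps exist by the direct method: uniform convexity makes minimizing
sequences Cauchy, and the Poincaré inequality makes the gradients of `W^{1,p}_0` a closed subspace
of `L^p`. Wolff functions come from solving their equation explicitly in polar coordinates of the
`(w, w')` plane. -/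

noncomputable section

namespace PCalderon

/-! ### Pointwise inequalities for `‖·‖ ^ P` -/

section Pointwise

variable {E : Type*} [NormedAddCommGroup E] [InnerProductSpace ℝ E] {P : ℝ}

theorem norm_rpow_sub_two_mul_inner_self (hP : 1 < P) (a : E) :
    ‖a‖ ^ (P - 2) * inner ℝ a a = ‖a‖ ^ P := by
  rcases eq_or_ne a 0 with rfl | ha
  · simp [Real.zero_rpow (by linarith : P ≠ 0)]
  · have h : 0 < ‖a‖ := norm_pos_iff.2 ha
    rw [real_inner_self_eq_norm_sq, ← Real.rpow_natCast, ← Real.rpow_add h]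
    norm_num

theorem rpow_sub_two_mul_self (hP : 1 < P) {x : ℝ} (hx : 0 ≤ x) :
    x ^ (P - 2) * x = x ^ (P - 1) := by
  rw [← Real.rpow_add_one' hx (by linarith)]
  ring_nf

theorem abs_norm_rpow_mul_inner_le (hP : 1 < P) (a b : E) :
    |‖a‖ ^ (P - 2) * inner ℝ a b| ≤ ‖a‖ ^ (P - 1) * ‖b‖ := by
  rw [abs_mul, abs_of_nonneg (by positivity), ← rpow_sub_two_mul_self hP (norm_nonneg a), mul_assoc]
  gcongr
  exact abs_real_inner_le_norm a b

/-- Young's inequality with a weight `s`. -/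
theorem young_weighted (hP : 1 < P) {s x y : ℝ} (hs : 0 < s) (hx : 0 ≤ x) (hy : 0 ≤ y) :
    P * (x ^ (P - 1) * y) ≤ s * y ^ P + (P - 1) * s ^ (-1 / (P - 1)) * x ^ P := by
  have hP0 : 0 < P := by linarith
  have hP1 : 0 < P - 1 := by linarith
  -- The weight is split as `s^(1/P) · s^(-1/P) = 1`, one factor going to each side of the product.
  have h := Real.young_inequality_of_nonneg (a := s ^ (1 / P) * y)
    (b := s ^ (-1 / P) * x ^ (P - 1)) (by positivity) (by positivity)
    (Real.HolderConjugate.conjExponent hP)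
  have e1 : s ^ (1 / P) * y * (s ^ (-1 / P) * x ^ (P - 1)) = x ^ (P - 1) * y := by
    have : s ^ (1 / P) * s ^ (-1 / P) = 1 := by
      rw [← Real.rpow_add hs]; simp [neg_div]
    linear_combination x ^ (P - 1) * y * this
  have e2 : (s ^ (1 / P) * y) ^ P = s * y ^ P := by
    rw [Real.mul_rpow (by positivity) hy, ← Real.rpow_mul hs.le]
    simp [hP0.ne']
  have e3 : (s ^ (-1 / P) * x ^ (P - 1)) ^ (Real.conjExponent P)
      = s ^ (-1 / (P - 1)) * x ^ P := by
    rw [Real.mul_rpow (by positivity) (by positivity), ← Real.rpow_mul hs.le,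
      ← Real.rpow_mul hx, Real.conjExponent]
    congr 2 <;> field_simp
  rw [e1, e2, e3, Real.conjExponent] at h
  have := mul_le_mul_of_nonneg_left h hP0.le
  calc _ ≤ _ := this
    _ = _ := by field_simp

/-- Cauchy-Schwarz followed by weighted Young. Taking `s = 1` gives the tangent inequality below;
taking `s = σ x` gives the lower bound of the Dirichlet-to-Neumann gap. -/
theorem flux_mul_le (hP : 1 < P) {s : ℝ} (hs : 0 < s) (a b : E) :
    P * (‖a‖ ^ (P - 2) * inner ℝ a b)
      ≤ s * ‖b‖ ^ P + (P - 1) * s ^ (-1 / (P - 1)) * ‖a‖ ^ P := by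
  refine le_trans ?_ (young_weighted hP hs (norm_nonneg a) (norm_nonneg b))
  have := (le_abs_self _).trans (abs_norm_rpow_mul_inner_le hP a b)
  gcongr

/-- Convexity of `‖·‖ ^ P`: the graph lies above its tangents. -/
theorem norm_rpow_le_add_flux (hP : 1 < P) (a b : E) :
    ‖a‖ ^ P ≤ ‖b‖ ^ P + P * (‖a‖ ^ (P - 2) * inner ℝ a (a - b)) := by
  have h := flux_mul_le hP one_pos a b
  rw [inner_sub_right, mul_sub, norm_rpow_sub_two_mul_inner_self hP]
  simp only [Real.one_rpow] at h
  linarith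

/-- The scalar factor may blow up at the origin when `P < 2`, but the product has norm `‖a‖ ^ (P -
1)`, which tends to zero. -/
theorem continuous_norm_rpow_smul (hP : 1 < P) :
    Continuous fun a : E => ‖a‖ ^ (P - 2) • a := by
  refine continuous_iff_continuousAt.2 fun a => ?_
  rcases eq_or_ne a 0 with rfl | ha
  · rw [ContinuousAt, smul_zero, tendsto_zero_iff_norm_tendsto_zero]
    have h : ∀ a : E, ‖‖a‖ ^ (P - 2) • a‖ = ‖a‖ ^ (P - 1) := fun a => by
      rw [norm_smul, Real.norm_of_nonneg (by positivity), rpow_sub_two_mul_self hP (norm_nonneg a)]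
    simp only [h]
    have : Continuous fun a : E => ‖a‖ ^ (P - 1) :=
      continuous_norm.rpow_const fun _ => Or.inr (by linarith)
    simpa [Real.zero_rpow (by linarith : P - 1 ≠ 0)] using this.tendsto 0
  · exact (continuousAt_id.norm.rpow_const (Or.inl (by simpa using ha))).smul continuousAt_id

/-- Average the tangent inequality at the midpoint over both endpoints: the linear terms cancel. -/
theorem norm_midpoint_rpow_le (hP : 1 < P) (a b : E) :
    ‖(1 / 2 : ℝ) • (a + b)‖ ^ P ≤ (‖a‖ ^ P + ‖b‖ ^ P) / 2 := by
  have h1 := norm_rpow_le_add_flux hP ((1 / 2 : ℝ) • (a + b)) a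
  have h2 := norm_rpow_le_add_flux hP ((1 / 2 : ℝ) • (a + b)) b
  have h3 : inner ℝ ((1 / 2 : ℝ) • (a + b)) ((1 / 2 : ℝ) • (a + b) - a)
      + inner ℝ ((1 / 2 : ℝ) • (a + b)) ((1 / 2 : ℝ) • (a + b) - b) = 0 := by
    rw [← inner_add_right]
    have : (1 / 2 : ℝ) • (a + b) - a + ((1 / 2 : ℝ) • (a + b) - b) = 0 := by module
    rw [this, inner_zero_right]
  have h4 : inner ℝ ((1 / 2 : ℝ) • (a + b)) ((1 / 2 : ℝ) • (a + b) - b)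
      = - inner ℝ ((1 / 2 : ℝ) • (a + b)) ((1 / 2 : ℝ) • (a + b) - a) := by linarith
  rw [h4] at h2
  linarith

/-- Strictness comes from the parallelogram law when the norms agree, and from strict convexity of
the real power when they differ. -/
theorem norm_midpoint_rpow_lt (hP : 1 < P) {a b : E} (hab : a ≠ b) :
    ‖(1 / 2 : ℝ) • (a + b)‖ ^ P < (‖a‖ ^ P + ‖b‖ ^ P) / 2 := by
  have hP0 : 0 < P := by linarith
  have htri : ‖(1 / 2 : ℝ) • (a + b)‖ ≤ (‖a‖ + ‖b‖) / 2 := by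
    rw [norm_smul]; norm_num; linarith [norm_add_le a b]
  by_cases hn : ‖a‖ = ‖b‖
  · have h2 : ‖(1 / 2 : ℝ) • (a + b)‖ < ‖a‖ := by
      have h := parallelogram_law_with_norm ℝ a b
      have h3 : 0 < ‖a - b‖ := norm_pos_iff.2 (sub_ne_zero.2 hab)
      rw [norm_smul]; norm_num
      rw [← hn] at h
      nlinarith [norm_nonneg (a + b), norm_nonneg a]
    rw [← hn]
    linarith [Real.rpow_lt_rpow (norm_nonneg _) h2 hP0]
  · have h := (strictConvexOn_rpow hP).2 (norm_nonneg a) (norm_nonneg b) hn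
      (by norm_num : (0 : ℝ) < 1 / 2) (by norm_num : (0 : ℝ) < 1 / 2) (by norm_num)
    simp only [smul_eq_mul] at h
    have h5 := Real.rpow_le_rpow (norm_nonneg _) htri hP0.le
    have : (‖a‖ + ‖b‖) / 2 = 1 / 2 * ‖a‖ + 1 / 2 * ‖b‖ := by ring
    rw [this] at h5
    linarith

/-- A form of the uniform convexity of `‖·‖ ^ P`. -/
theorem exists_norm_sub_rpow_le [FiniteDimensional ℝ E] (hP : 1 < P) {ε : ℝ} (hε : 0 < ε) :
    ∃ K : ℝ, 0 ≤ K ∧ ∀ a b : E, ‖a - b‖ ^ P ≤ ε * (‖a‖ ^ P + ‖b‖ ^ P)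
      + K * ((‖a‖ ^ P + ‖b‖ ^ P) / 2 - ‖(1 / 2 : ℝ) • (a + b)‖ ^ P) := by
  have hP0 : 0 < P := by linarith
  let f : E × E → ℝ := fun z => ‖z.1 - z.2‖ ^ P - ε * (‖z.1‖ ^ P + ‖z.2‖ ^ P)
  let g : E × E → ℝ := fun z =>
    (‖z.1‖ ^ P + ‖z.2‖ ^ P) / 2 - ‖(1 / 2 : ℝ) • (z.1 + z.2)‖ ^ P
  have hc : ∀ h : E × E → E, Continuous h → Continuous fun z => ‖h z‖ ^ P := fun h hh =>
    hh.norm.rpow_const fun _ => Or.inr hP0.le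
  have hf : Continuous f :=
    (hc _ (by fun_prop)).sub (((hc _ continuous_fst).add (hc _ continuous_snd)).const_mul ε)
  have hg : Continuous g :=
    (((hc _ continuous_fst).add (hc _ continuous_snd)).div_const 2).sub (hc _ (by fun_prop))
  have hg0 : ∀ z, 0 ≤ g z := fun z => sub_nonneg.2 (norm_midpoint_rpow_le hP _ _)
  -- All terms are homogeneous of degree `P`, so the unit sphere suffices. Where `f < 0` nothing is
  -- needed. On the compact set `S` the diagonal is excluded, since there `f = -2ε`, so the
  -- convexity defect `g` has a positive minimum and `K = max f / min g` works.
  let S : Set (E × E) := Metric.sphere 0 1 ∩ {z | 0 ≤ f z}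
  have hS : IsCompact S := (isCompact_sphere _ _).inter_right (isClosed_le continuous_const hf)
  have hSK : ∃ K : ℝ, 0 ≤ K ∧ ∀ z ∈ Metric.sphere (0 : E × E) 1, f z ≤ K * g z := by
    rcases S.eq_empty_or_nonempty with hemp | hne
    · refine ⟨0, le_rfl, fun z hz => ?_⟩
      by_contra hcon
      have : z ∈ S := ⟨hz, by simp at hcon ⊢; exact hcon.le⟩
      simp [hemp] at this
    · obtain ⟨z₀, hz₀, hmin⟩ := hS.exists_isMinOn hne hg.continuousOn
      obtain ⟨z₁, hz₁, hmax⟩ := hS.exists_isMaxOn hne hf.continuousOn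
      have hpos : 0 < g z₀ := by
        refine sub_pos.2 (norm_midpoint_rpow_lt hP fun heq => ?_)
        have h1 : 0 ≤ f z₀ := hz₀.2
        have h2 : ‖z₀‖ = 1 := by simpa using hz₀.1
        rw [Prod.norm_def, heq, max_self] at h2
        simp only [f, heq, sub_self, norm_zero, Real.zero_rpow hP0.ne', h2, Real.one_rpow] at h1
        linarith
      have hf1 : 0 ≤ f z₁ := hz₁.2
      refine ⟨f z₁ / g z₀, by positivity, fun z hz => ?_⟩
      by_cases hz' : 0 ≤ f z
      · calc f z ≤ f z₁ := hmax ⟨hz, hz'⟩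
          _ = f z₁ / g z₀ * g z₀ := by field_simp
          _ ≤ f z₁ / g z₀ * g z := by
            gcongr
            exact hmin ⟨hz, hz'⟩
      · have := hg0 z
        have : 0 ≤ f z₁ / g z₀ * g z := by positivity
        linarith
  obtain ⟨K, hK0, hK⟩ := hSK
  refine ⟨K, hK0, fun a b => ?_⟩
  by_cases h0 : (a, b) = 0
  · obtain ⟨rfl, rfl⟩ := Prod.mk_eq_zero.1 h0
    simp [Real.zero_rpow hP0.ne']
  · set r : ℝ := ‖(a, b)‖ with hr
    have hr0 : 0 < r := norm_pos_iff.2 h0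
    have hz : r⁻¹ • (a, b) ∈ Metric.sphere (0 : E × E) 1 := by
      rw [mem_sphere_zero_iff_norm, norm_smul, norm_inv, norm_norm]
      exact inv_mul_cancel₀ hr0.ne'
    have h := hK _ hz
    have hsc : ∀ c : E, ‖r⁻¹ • c‖ ^ P = (r⁻¹) ^ P * ‖c‖ ^ P := fun c => by
      rw [norm_smul, Real.norm_of_nonneg (by positivity),
        Real.mul_rpow (by positivity) (norm_nonneg _)]
    simp only [f, g, Prod.smul_mk, ← smul_sub, ← smul_add, smul_comm (1 / 2 : ℝ) r⁻¹, hsc] at h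
    have hrp : 0 < (r⁻¹) ^ P := by positivity
    refine le_of_mul_le_mul_left ?_ hrp
    linarith

end Pointwise

/-- A measurable weight that is bounded above and bounded away from zero. -/
structure IsElliptic {α : Type*} [MeasurableSpace α] (σ : α → ℝ) : Prop where
  measurable : Measurable σ
  lower : ∃ m : ℝ, 0 < m ∧ ∀ x, m ≤ σ x
  upper : ∃ M : ℝ, ∀ x, σ x ≤ M

/-! ### Weighted energies of `L^p` vector fields: minimizers and the Euler-Lagrange equation -/

section LpEnergy

variable {α E : Type*} [MeasurableSpace α] {μ : Measure α}
  [NormedAddCommGroup E] {p : ℝ≥0∞} {σ : α → ℝ}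

theorem IsElliptic.nonneg (hσ : IsElliptic σ) (x : α) : 0 ≤ σ x := by
  obtain ⟨m, hm, h⟩ := hσ.lower
  exact hm.le.trans (h x)

theorem IsElliptic.pos (hσ : IsElliptic σ) (x : α) : 0 < σ x := by
  obtain ⟨m, hm, h⟩ := hσ.lower
  exact hm.trans_le (h x)

theorem IsElliptic.integrable_mul (hσ : IsElliptic σ) {f : α → ℝ} (hf : Integrable f μ) :
    Integrable (fun x => σ x * f x) μ := by
  obtain ⟨M, hM⟩ := hσ.upper
  refine hf.bdd_mul (c := M) hσ.measurable.aestronglyMeasurable (ae_of_all _ fun x => ?_)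
  rw [Real.norm_of_nonneg (hσ.nonneg x)]
  exact hM x

theorem isElliptic_one : IsElliptic (1 : α → ℝ) :=
  ⟨measurable_one, ⟨1, one_pos, fun _ => le_rfl⟩, ⟨1, fun _ => le_rfl⟩⟩

theorem one_lt_toReal (hp₁ : 1 < p) (hp : p ≠ ⊤) : 1 < p.toReal := by
  simpa using (ENNReal.toReal_lt_toReal ENNReal.one_ne_top hp).2 hp₁

theorem integrable_norm_rpow' (hp₁ : 1 < p) (hp : p ≠ ⊤) {G : α → E} (hG : MemLp G p μ) :
    Integrable (fun x => ‖G x‖ ^ p.toReal) μ :=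
  hG.integrable_norm_rpow (zero_lt_one.trans hp₁).ne' hp

theorem Lp_norm_rpow_eq (hp₁ : 1 < p) (hp : p ≠ ⊤) (G : Lp E p μ) :
    ‖G‖ ^ p.toReal = ∫ x, ‖G x‖ ^ p.toReal ∂μ := by
  have hP := one_lt_toReal hp₁ hp
  have h0 : 0 ≤ ∫ x, ‖G x‖ ^ p.toReal ∂μ := integral_nonneg fun x => by positivity
  rw [Lp.norm_def, (Lp.memLp G).eLpNorm_eq_integral_rpow_norm (zero_lt_one.trans hp₁).ne' hp,
    ENNReal.toReal_ofReal (by positivity), ← Real.rpow_mul h0, inv_mul_cancel₀ (by linarith),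
    Real.rpow_one]

/-- The weighted energy `∫ σ ‖G‖ ^ p` of a vector field. -/
def lpEnergy (σ : α → ℝ) (G : Lp E p μ) : ℝ := ∫ x, σ x * ‖G x‖ ^ p.toReal ∂μ

theorem integrable_lpEnergy (hp₁ : 1 < p) (hp : p ≠ ⊤) (hσ : IsElliptic σ) (G : Lp E p μ) :
    Integrable (fun x => σ x * ‖G x‖ ^ p.toReal) μ :=
  hσ.integrable_mul (integrable_norm_rpow' hp₁ hp (Lp.memLp G))

theorem lpEnergy_nonneg (hσ : IsElliptic σ) (G : Lp E p μ) : 0 ≤ lpEnergy σ G :=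
  integral_nonneg fun x => mul_nonneg (hσ.nonneg x) (by positivity)

variable [InnerProductSpace ℝ E]

/-- The norm of the flux is at most `M ‖G‖ ^ (p - 1)`, and raising this to `p / (p - 1)` gives back
`‖G‖ ^ p`. -/
theorem memLp_flux (hp₁ : 1 < p) (hp : p ≠ ⊤) (hσ : IsElliptic σ) {G : α → E}
    (hG : MemLp G p μ) :
    MemLp (fun x => (σ x * ‖G x‖ ^ (p.toReal - 2)) • G x) (ENNReal.conjExponent p) μ := by
  have hP := one_lt_toReal hp₁ hp
  have h1 := hG.norm_rpow_div (p - 1)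
  have h2 : (p - 1).toReal = p.toReal - 1 := by
    rw [ENNReal.toReal_sub_of_le hp₁.le hp]; simp
  have h0 : p - 1 ≠ 0 := (tsub_pos_of_lt hp₁).ne'
  have h0' : p - 1 ≠ ⊤ := ENNReal.sub_ne_top hp
  have h3 : p / (p - 1) = ENNReal.conjExponent p := by
    rw [ENNReal.conjExponent]
    nth_rewrite 1 [← tsub_add_cancel_of_le hp₁.le]
    rw [ENNReal.add_div, ENNReal.div_self h0 h0', one_div]
  rw [h2, h3] at h1
  obtain ⟨M, hM⟩ := hσ.upper
  refine MemLp.of_le_mul (c := M) h1 ?_ (ae_of_all _ fun x => ?_)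
  · refine AEStronglyMeasurable.smul (𝕜 := ℝ) ?_ hG.1
    exact (hσ.measurable.aemeasurable.mul
      (hG.1.norm.aemeasurable.pow_const _)).aestronglyMeasurable
  · rw [norm_smul, Real.norm_of_nonneg (mul_nonneg (hσ.nonneg x) (by positivity)), mul_assoc,
      rpow_sub_two_mul_self hP (norm_nonneg _), Real.norm_of_nonneg (by positivity)]
    gcongr
    exact hM x

theorem integrable_flux (hp₁ : 1 < p) (hp : p ≠ ⊤) (hσ : IsElliptic σ) {G H : α → E}
    (hG : MemLp G p μ) (hH : MemLp H p μ) :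
    Integrable (fun x => σ x * ‖G x‖ ^ (p.toReal - 2) * inner ℝ (G x) (H x)) μ := by
  have : Fact (1 ≤ p) := ⟨hp₁.le⟩
  have : ENNReal.HolderTriple (ENNReal.conjExponent p) p 1 :=
    (inferInstance : ENNReal.HolderConjugate p (ENNReal.conjExponent p)).symm
  have h := (innerSL ℝ).memLp_of_bilin 1 (memLp_flux hp₁ hp hσ hG) hH
  refine (memLp_one_iff_integrable.1 h).congr (ae_of_all _ fun x => ?_)
  simp only
  rw [innerSL_apply_apply, real_inner_smul_left]

/-- The pairing `∫ σ ‖G‖ ^ (p - 2) G · H`. -/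
def lpFlux (σ : α → ℝ) (G H : Lp E p μ) : ℝ :=
  ∫ x, σ x * ‖G x‖ ^ (p.toReal - 2) * inner ℝ (G x) (H x) ∂μ

/-- Hölder duality. This is the source of linearity and continuity of the pairing in its second
argument. -/
theorem exists_clm_eq_lpFlux (hp₁ : 1 < p) (hp : p ≠ ⊤) [Fact (1 ≤ p)] (hσ : IsElliptic σ)
    (G : Lp E p μ) : ∃ L : StrongDual ℝ (Lp E p μ), ∀ H, L H = lpFlux σ G H := by
  have hc : ENNReal.HolderConjugate p (ENNReal.conjExponent p) := inferInstance
  have : ENNReal.HolderConjugate (ENNReal.conjExponent p) p := hc.symm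
  have : Fact (1 ≤ ENNReal.conjExponent p) := ⟨by simp [ENNReal.conjExponent]⟩
  have hm := memLp_flux hp₁ hp hσ (Lp.memLp G)
  refine ⟨(innerSL ℝ : E →L[ℝ] E →L[ℝ] ℝ).lpPairing μ (ENNReal.conjExponent p) p (hm.toLp _),
    fun H => ?_⟩
  rw [ContinuousLinearMap.lpPairing_eq_integral, lpFlux]
  refine integral_congr_ae ?_
  filter_upwards [hm.coeFn_toLp] with x hx
  rw [hx, innerSL_apply_apply, real_inner_smul_left]

theorem lpFlux_self (hp₁ : 1 < p) (hp : p ≠ ⊤) (G : Lp E p μ) :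
    lpFlux σ G G = lpEnergy σ G := by
  refine integral_congr_ae (ae_of_all _ fun x => ?_)
  simp only [mul_assoc]
  rw [norm_rpow_sub_two_mul_inner_self (one_lt_toReal hp₁ hp)]

/-- The integrated tangent inequality. It replaces lower semicontinuity and differentiation of the
energy in what follows. -/
theorem lpEnergy_le_add_lpFlux (hp₁ : 1 < p) (hp : p ≠ ⊤) (hσ : IsElliptic σ)
    (G H : Lp E p μ) :
    lpEnergy σ G ≤ lpEnergy σ H + p.toReal * lpFlux σ G (G - H) := by
  have hP := one_lt_toReal hp₁ hp
  rw [lpEnergy, lpEnergy, lpFlux, ← integral_const_mul, ← integral_add]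
  · refine integral_mono_ae (integrable_lpEnergy hp₁ hp hσ G) ?_ ?_
    · exact (integrable_lpEnergy hp₁ hp hσ H).add
        ((integrable_flux hp₁ hp hσ (Lp.memLp G) (Lp.memLp (G - H))).const_mul _)
    · filter_upwards [Lp.coeFn_sub G H] with x hx
      have := mul_le_mul_of_nonneg_left (norm_rpow_le_add_flux hP (G x) (H x)) (hσ.nonneg x)
      rw [hx, Pi.sub_apply]
      linarith
  · exact integrable_lpEnergy hp₁ hp hσ H
  · exact (integrable_flux hp₁ hp hσ (Lp.memLp G) (Lp.memLp (G - H))).const_mul _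

/-- Nearly minimizing pairs are close to each other. -/
theorem exists_norm_sub_rpow_le_lpEnergy [FiniteDimensional ℝ E] (hp₁ : 1 < p) (hp : p ≠ ⊤)
    (hσ : IsElliptic σ) {ε : ℝ} (hε : 0 < ε) :
    ∃ K : ℝ, 0 ≤ K ∧ ∀ G H : Lp E p μ, ‖G - H‖ ^ p.toReal
      ≤ ε * (lpEnergy σ G + lpEnergy σ H)
      + K * ((lpEnergy σ G + lpEnergy σ H) / 2 - lpEnergy σ ((1 / 2 : ℝ) • (G + H))) := by
  have hP := one_lt_toReal hp₁ hp
  obtain ⟨m, hm, hmσ⟩ := hσ.lower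
  -- The left-hand side is only controlled through `m ≤ σ`, so everything is divided by `m` at the
  -- end; hence `m * ε` here.
  obtain ⟨K, hK0, hK⟩ := exists_norm_sub_rpow_le (E := E) hP (mul_pos hm hε)
  refine ⟨K / m, by positivity, fun G H => ?_⟩
  have key : m * ‖G - H‖ ^ p.toReal ≤ (m * ε) * (lpEnergy σ G + lpEnergy σ H)
      + K * ((lpEnergy σ G + lpEnergy σ H) / 2 - lpEnergy σ ((1 / 2 : ℝ) • (G + H))) := by
    have iG := integrable_lpEnergy hp₁ hp hσ G
    have iH := integrable_lpEnergy hp₁ hp hσ H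
    have iM := integrable_lpEnergy hp₁ hp hσ ((1 / 2 : ℝ) • (G + H))
    have e : (m * ε) * (lpEnergy σ G + lpEnergy σ H)
        + K * ((lpEnergy σ G + lpEnergy σ H) / 2 - lpEnergy σ ((1 / 2 : ℝ) • (G + H)))
        = ∫ x, ((m * ε + K / 2) * (σ x * ‖G x‖ ^ p.toReal)
          + (m * ε + K / 2) * (σ x * ‖H x‖ ^ p.toReal)
          - K * (σ x * ‖((1 / 2 : ℝ) • (G + H) : Lp E p μ) x‖ ^ p.toReal)) ∂μ := by
      have iGH : Integrable (fun x => (m * ε + K / 2) * (σ x * ‖G x‖ ^ p.toReal)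
          + (m * ε + K / 2) * (σ x * ‖H x‖ ^ p.toReal)) μ := (iG.const_mul _).add (iH.const_mul _)
      rw [integral_sub iGH (iM.const_mul _),
        integral_add (iG.const_mul _) (iH.const_mul _), integral_const_mul, integral_const_mul,
        integral_const_mul, lpEnergy, lpEnergy, lpEnergy]
      ring
    rw [e, Lp_norm_rpow_eq hp₁ hp, ← integral_const_mul]
    refine integral_mono_ae
      ((integrable_norm_rpow' hp₁ hp (Lp.memLp (G - H))).const_mul _)
      (((iG.const_mul _).add (iH.const_mul _)).sub (iM.const_mul _)) ?_
    filter_upwards [Lp.coeFn_sub G H, Lp.coeFn_smul (1 / 2 : ℝ) (G + H), Lp.coeFn_add G H]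
      with x h1 h2 h3
    simp only [h1, h2, Pi.smul_apply, h3, Pi.add_apply, Pi.sub_apply]
    have h := mul_le_mul_of_nonneg_left (hK (G x) (H x)) (hσ.nonneg x)
    have h' : m * ‖G x - H x‖ ^ p.toReal ≤ σ x * ‖G x - H x‖ ^ p.toReal := by
      gcongr
      exact hmσ x
    linarith
  refine le_of_mul_le_mul_left (key.trans_eq ?_) hm
  field_simp

/-- Direct method with strong convergence: midpoints of a minimizing sequence also compete, so their
convexity defect is small and uniform convexity makes the sequence Cauchy. -/
theorem exists_lpEnergy_minimizer [FiniteDimensional ℝ E] (hp₁ : 1 < p) (hp : p ≠ ⊤)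
    [Fact (1 ≤ p)] (hσ : IsElliptic σ) (S : Submodule ℝ (Lp E p μ))
    (hS : IsClosed (S : Set (Lp E p μ))) (G : Lp E p μ) :
    ∃ H ∈ S, ∀ H' ∈ S, lpEnergy σ (G + H) ≤ lpEnergy σ (G + H') := by
  have hP := one_lt_toReal hp₁ hp
  set A : Set ℝ := (fun H => lpEnergy σ (G + H)) '' (S : Set (Lp E p μ)) with hA
  have hne : A.Nonempty := ⟨_, 0, S.zero_mem, rfl⟩
  have hbdd : BddBelow A := ⟨0, by rintro _ ⟨H, -, rfl⟩; exact lpEnergy_nonneg hσ _⟩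
  set m := sInf A
  have hm : ∀ H ∈ S, m ≤ lpEnergy σ (G + H) := fun H hH => csInf_le hbdd ⟨H, hH, rfl⟩
  have hm0 : 0 ≤ m := le_csInf hne (by rintro _ ⟨H, -, rfl⟩; exact lpEnergy_nonneg hσ _)
  have hex : ∀ n : ℕ, ∃ H ∈ S, lpEnergy σ (G + H) < m + 1 / ((n : ℝ) + 1) := fun n => by
    obtain ⟨_, ⟨H, hH, rfl⟩, h⟩ := exists_lt_of_csInf_lt hne
      (lt_add_of_pos_right m (by positivity : (0 : ℝ) < 1 / ((n : ℝ) + 1)))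
    exact ⟨H, hH, h⟩
  choose H hHS hH using hex
  have hcauchy : CauchySeq H := by
    refine Metric.cauchySeq_iff.2 fun δ hδ => ?_
    have hδP : 0 < δ ^ p.toReal := by positivity
    -- Two late energies add up to at most `2 (m + 1)`, so this `ε` makes the first term at most
    -- `δ^P / 2`; `N` is then chosen to keep the defect term below `δ^P / 2`.
    obtain ⟨K, hK0, hK⟩ := exists_norm_sub_rpow_le_lpEnergy (μ := μ) (E := E) hp₁ hp hσ
      (ε := δ ^ p.toReal / (4 * (m + 1))) (by positivity)
    obtain ⟨N, hN⟩ := exists_nat_one_div_lt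
      (show 0 < δ ^ p.toReal / (4 * (K + 1)) by positivity)
    have hNn : ∀ n, N ≤ n → lpEnergy σ (G + H n) < m + 1 / ((N : ℝ) + 1) := fun n hn => by
      refine (hH n).trans_le ?_
      gcongr
    refine ⟨N, fun i hi j hj => ?_⟩
    have h1 := hK (G + H i) (G + H j)
    have hmid : (1 / 2 : ℝ) • (G + H i + (G + H j)) = G + (1 / 2 : ℝ) • (H i + H j) := by module
    have h2 := hm _ (S.smul_mem (1 / 2 : ℝ) (S.add_mem (hHS i) (hHS j)))
    rw [hmid, add_sub_add_left_eq_sub] at h1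
    have hi' := hNn i hi
    have hj' := hNn j hj
    have hN1 : 1 / ((N : ℝ) + 1) ≤ 1 := by
      rw [div_le_one (by positivity)]; linarith [Nat.cast_nonneg (α := ℝ) N]
    rw [dist_eq_norm]
    refine lt_of_not_ge fun hge => ?_
    have hge' := Real.rpow_le_rpow hδ.le hge (by linarith : 0 ≤ p.toReal)
    have t1 : δ ^ p.toReal / (4 * (m + 1)) * (lpEnergy σ (G + H i) + lpEnergy σ (G + H j))
        ≤ δ ^ p.toReal / 2 := by
      calc _ ≤ δ ^ p.toReal / (4 * (m + 1)) * (2 * (m + 1)) := by gcongr; linarith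
        _ = _ := by field_simp; norm_num
    have t2 : K * ((lpEnergy σ (G + H i) + lpEnergy σ (G + H j)) / 2
        - lpEnergy σ (G + (1 / 2 : ℝ) • (H i + H j))) < δ ^ p.toReal / 2 := by
      calc _ ≤ K * (δ ^ p.toReal / (4 * (K + 1))) := by gcongr; linarith
        _ < (K + 1) * (δ ^ p.toReal / (2 * (K + 1))) := by
          refine mul_lt_mul'' (by linarith) ?_ hK0 (by positivity)
          gcongr
          norm_num
        _ = _ := by field_simp
    linarith
  obtain ⟨H₀, hlim⟩ := cauchySeq_tendsto_of_complete hcauchy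
  have hH₀ : H₀ ∈ S := hS.mem_of_tendsto hlim (Eventually.of_forall hHS)
  refine ⟨H₀, hH₀, fun H' hH' => le_trans ?_ (hm H' hH')⟩
  -- The tangent functional at the limit bounds the limit energy by the energies along the sequence
  -- plus a vanishing linear term.
  obtain ⟨L, hL⟩ := exists_clm_eq_lpFlux hp₁ hp hσ (G + H₀)
  have hb : ∀ n : ℕ, lpEnergy σ (G + H₀)
      ≤ m + 1 / ((n : ℝ) + 1) + p.toReal * L (H₀ - H n) := fun n => by
    have h := lpEnergy_le_add_lpFlux hp₁ hp hσ (G + H₀) (G + H n)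
    rw [add_sub_add_left_eq_sub, ← hL] at h
    linarith [hH n]
  have hlim2 : Tendsto (fun n : ℕ => m + 1 / ((n : ℝ) + 1) + p.toReal * L (H₀ - H n)) atTop
      (𝓝 (m + 0 + p.toReal * L (H₀ - H₀))) :=
    (tendsto_const_nhds.add tendsto_one_div_add_atTop_nhds_zero_nat).add
      (((L.continuous.tendsto _).comp (tendsto_const_nhds.sub hlim)).const_mul _)
  simpa using ge_of_tendsto' hlim2 hb

/-- The hypotheses make the convexity defect nonpositive, so uniform convexity leaves `‖G - H‖ ^ p ≤
ε · const` for every `ε > 0`. -/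
theorem eq_of_lpEnergy_le_midpoint [FiniteDimensional ℝ E] (hp₁ : 1 < p) (hp : p ≠ ⊤)
    [Fact (1 ≤ p)] (hσ : IsElliptic σ) {G H : Lp E p μ}
    (hG : lpEnergy σ G ≤ lpEnergy σ ((1 / 2 : ℝ) • (G + H)))
    (hH : lpEnergy σ H ≤ lpEnergy σ ((1 / 2 : ℝ) • (G + H))) : G = H := by
  have hP := one_lt_toReal hp₁ hp
  have h : ∀ ε : ℝ, 0 < ε → ‖G - H‖ ^ p.toReal ≤ ε * (lpEnergy σ G + lpEnergy σ H) :=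
    fun ε hε => by
      obtain ⟨K, hK0, hK⟩ := exists_norm_sub_rpow_le_lpEnergy (μ := μ) (E := E) hp₁ hp hσ hε
      have h1 := hK G H
      have : K * ((lpEnergy σ G + lpEnergy σ H) / 2 - lpEnergy σ ((1 / 2 : ℝ) • (G + H))) ≤ 0 :=
        mul_nonpos_of_nonneg_of_nonpos hK0 (by linarith)
      linarith
  have h0 : ‖G - H‖ ^ p.toReal ≤ 0 := by
    have hs : 0 ≤ lpEnergy σ G + lpEnergy σ H :=
      add_nonneg (lpEnergy_nonneg hσ _) (lpEnergy_nonneg hσ _)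
    refine le_of_forall_pos_le_add fun ε hε => ?_
    refine (h (ε / (lpEnergy σ G + lpEnergy σ H + 1)) (by positivity)).trans ?_
    rw [zero_add, div_mul_eq_mul_div, div_le_iff₀ (by positivity)]
    nlinarith
  have h1 : ‖G - H‖ ^ p.toReal = 0 := le_antisymm h0 (by positivity)
  rw [Real.rpow_eq_zero (norm_nonneg _) (by linarith)] at h1
  exact sub_eq_zero.1 (norm_eq_zero.1 h1)

/-- Dominated convergence with majorant `M (‖G‖ + ‖H‖) ^ p`, valid for `|t| < 1`. -/
theorem tendsto_lpFlux_add_smul (hp₁ : 1 < p) (hp : p ≠ ⊤) [Fact (1 ≤ p)]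
    (hσ : IsElliptic σ) (G H : Lp E p μ) :
    Tendsto (fun t : ℝ => lpFlux σ (G + t • H) H) (𝓝 0) (𝓝 (lpFlux σ G H)) := by
  have hP := one_lt_toReal hp₁ hp
  let F : ℝ → α → ℝ := fun t x =>
    σ x * inner ℝ (‖G x + t • H x‖ ^ (p.toReal - 2) • (G x + t • H x)) (H x)
  have hF : ∀ t : ℝ, lpFlux σ (G + t • H) H = ∫ x, F t x ∂μ := fun t => by
    refine integral_congr_ae ?_
    filter_upwards [Lp.coeFn_add G (t • H), Lp.coeFn_smul t H] with x h1 h2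
    simp only [F, h1, Pi.add_apply, h2, Pi.smul_apply, real_inner_smul_left, mul_assoc]
  have h0 : lpFlux σ G H = ∫ x, F 0 x ∂μ := by rw [← hF]; simp
  simp only [hF, h0]
  obtain ⟨M, hM⟩ := hσ.upper
  refine tendsto_integral_filter_of_dominated_convergence
    (fun x => M * (‖G x‖ + ‖H x‖) ^ p.toReal) ?_ ?_ ?_ ?_
  · refine Eventually.of_forall fun t => ?_
    refine hσ.measurable.aestronglyMeasurable.mul (AEStronglyMeasurable.inner ?_
      (Lp.aestronglyMeasurable H))
    exact (continuous_norm_rpow_smul hP).comp_aestronglyMeasurable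
      ((Lp.aestronglyMeasurable G).add ((Lp.aestronglyMeasurable H).const_smul t))
  · have : ∀ᶠ t : ℝ in 𝓝 0, |t| < 1 := by
      have := Metric.ball_mem_nhds (0 : ℝ) one_pos
      filter_upwards [this] with t ht
      simpa using ht
    filter_upwards [this] with t ht
    refine ae_of_all _ fun x => ?_
    simp only [F]
    rw [real_inner_smul_left, norm_mul, Real.norm_of_nonneg (hσ.nonneg x), Real.norm_eq_abs]
    have h1 : ‖G x + t • H x‖ ≤ ‖G x‖ + ‖H x‖ := by
      refine (norm_add_le _ _).trans ?_
      rw [norm_smul, Real.norm_eq_abs]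
      have := mul_le_mul_of_nonneg_right ht.le (norm_nonneg (H x))
      linarith
    have h2 : |‖G x + t • H x‖ ^ (p.toReal - 2) * inner ℝ (G x + t • H x) (H x)|
        ≤ (‖G x‖ + ‖H x‖) ^ p.toReal := by
      refine (abs_norm_rpow_mul_inner_le hP _ _).trans ?_
      calc _ ≤ (‖G x‖ + ‖H x‖) ^ (p.toReal - 1) * (‖G x‖ + ‖H x‖) := by
            gcongr
            linarith [norm_nonneg (G x)]
        _ = _ := by
            rw [← Real.rpow_add_one' (by positivity) (by linarith)]
            ring_nf
    exact mul_le_mul (hM x) h2 (abs_nonneg _) ((hσ.nonneg x).trans (hM x))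
  · have hm : MemLp (fun x => ‖G x‖ + ‖H x‖) p μ := (Lp.memLp G).norm.add (Lp.memLp H).norm
    have := integrable_norm_rpow' hp₁ hp hm
    refine (this.const_mul M).congr (ae_of_all _ fun x => ?_)
    simp only
    rw [Real.norm_of_nonneg (by positivity)]
  · refine ae_of_all _ fun x => ?_
    have hc : Continuous fun t : ℝ => F t x :=
      continuous_const.mul (((continuous_norm_rpow_smul hP).comp (by fun_prop)).inner
        continuous_const)
    exact hc.tendsto 0

/-- The tangent at `G + t H` gives `0 ≤ p t · lpFlux σ (G + t H) H`; divide by `p t > 0` and let `t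
→ 0`. -/
theorem lpFlux_nonneg_of_le (hp₁ : 1 < p) (hp : p ≠ ⊤) [Fact (1 ≤ p)]
    (hσ : IsElliptic σ) {G H : Lp E p μ}
    (h : ∀ t : ℝ, lpEnergy σ G ≤ lpEnergy σ (G + t • H)) : 0 ≤ lpFlux σ G H := by
  have hP := one_lt_toReal hp₁ hp
  have hlim := (tendsto_lpFlux_add_smul hp₁ hp hσ G H).mono_left
    (nhdsWithin_le_nhds (s := Set.Ioi 0))
  refine ge_of_tendsto hlim ?_
  filter_upwards [self_mem_nhdsWithin] with t ht
  have h1 := lpEnergy_le_add_lpFlux hp₁ hp hσ (G + t • H) G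
  obtain ⟨L, hL⟩ := exists_clm_eq_lpFlux hp₁ hp hσ (G + t • H)
  rw [add_sub_cancel_left, ← hL, map_smul, hL, smul_eq_mul] at h1
  have h2 : 0 ≤ (p.toReal * t) * lpFlux σ (G + t • H) H := by linarith [h t]
  exact nonneg_of_mul_nonneg_right h2 (mul_pos (by linarith) ht)

/-- The Euler-Lagrange equation. -/
theorem lpFlux_eq_zero_of_le (hp₁ : 1 < p) (hp : p ≠ ⊤) [Fact (1 ≤ p)]
    (hσ : IsElliptic σ) {G H : Lp E p μ}
    (h : ∀ t : ℝ, lpEnergy σ G ≤ lpEnergy σ (G + t • H)) : lpFlux σ G H = 0 := by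
  refine le_antisymm ?_ (lpFlux_nonneg_of_le hp₁ hp hσ h)
  have h1 := lpFlux_nonneg_of_le hp₁ hp hσ (G := G) (H := -H) fun t => by
    simpa using h (-t)
  obtain ⟨L, hL⟩ := exists_clm_eq_lpFlux hp₁ hp hσ G
  rw [← hL, map_neg, hL] at h1
  linarith

end LpEnergy

/-! ### Sobolev functions, weak gradients and `W^{1,p}_0` -/

section Sobolev

variable {d : ℕ} {p : ℝ≥0∞} [Fact (1 ≤ p)] {Ω : Set (Space d)}

theorem IsTestFunction.eq_zero {φ : Space d → ℝ} (hφ : IsTestFunction Ω φ) {x : Space d}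
    (hx : x ∉ Ω) : φ x = 0 :=
  image_eq_zero_of_notMem_tsupport fun h => hx (hφ.support h)

theorem IsTestFunction.fderiv_eq_zero {φ : Space d → ℝ} (hφ : IsTestFunction Ω φ)
    {x : Space d} (hx : x ∉ Ω) : fderiv ℝ φ x = 0 := by
  by_contra h
  exact hx (hφ.support (support_fderiv_subset ℝ h))

theorem IsTestFunction.continuous_fderiv_apply {φ : Space d → ℝ} (hφ : IsTestFunction Ω φ)
    (e : Space d) : Continuous fun x => fderiv ℝ φ x e :=
  (hφ.smooth.continuous_fderiv (by simp)).clm_apply continuous_const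

/-- Integration by parts against a compactly supported function. -/
theorem integral_fderiv_mul_eq {φ h : Space d → ℝ} (hφ : ContDiff ℝ 1 φ)
    (hφc : HasCompactSupport φ) (hh : ContDiff ℝ 1 h) (e : Space d) :
    ∫ x, fderiv ℝ φ x e * h x = - ∫ x, φ x * fderiv ℝ h x e := by
  have c1 : Continuous fun x => fderiv ℝ φ x e :=
    (hφ.continuous_fderiv (by simp)).clm_apply continuous_const
  have c2 : Continuous fun x => fderiv ℝ h x e :=
    (hh.continuous_fderiv (by simp)).clm_apply continuous_const
  have k1 : HasCompactSupport fun x => fderiv ℝ φ x e := hφc.fderiv_apply ℝ e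
  rw [integral_mul_fderiv_eq_neg_fderiv_mul_of_integrable, neg_neg]
  · exact (c1.mul hh.continuous).integrable_of_hasCompactSupport k1.mul_right
  · exact (hφ.continuous.mul c2).integrable_of_hasCompactSupport hφc.mul_right
  · exact (hφ.continuous.mul hh.continuous).integrable_of_hasCompactSupport hφc.mul_right
  · exact fun x _ => hφ.differentiable (by simp) x
  · exact fun x _ => hh.differentiable (by simp) x

theorem IsTestFunction.setIntegral_fderiv_mul {φ h : Space d → ℝ} (hφ : IsTestFunction Ω φ)
    (hh : ContDiff ℝ 1 h) (e : Space d) :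
    ∫ x in Ω, fderiv ℝ φ x e * h x = - ∫ x in Ω, φ x * fderiv ℝ h x e := by
  rw [setIntegral_eq_integral_of_forall_compl_eq_zero,
    setIntegral_eq_integral_of_forall_compl_eq_zero]
  · exact integral_fderiv_mul_eq (hφ.smooth.of_le (by simp)) hφ.compact hh e
  · intro x hx
    simp [hφ.eq_zero hx]
  · intro x hx
    simp [hφ.fderiv_eq_zero hx]

theorem hasWeakGradient_gradient {h : Space d → ℝ} (hh : ContDiff ℝ 1 h) :
    HasWeakGradient Ω h (gradient h) := fun φ hφ e => by
  simp only [inner_gradient_left]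
  exact hφ.setIntegral_fderiv_mul hh e

theorem HasWeakGradient.congr {u v : Space d → ℝ} {G H : Space d → Space d}
    (h : HasWeakGradient Ω u G) (huv : u =ᵐ[volume.restrict Ω] v)
    (hGH : G =ᵐ[volume.restrict Ω] H) : HasWeakGradient Ω v H := fun φ hφ e => by
  have h1 : ∫ x in Ω, fderiv ℝ φ x e * v x = ∫ x in Ω, fderiv ℝ φ x e * u x :=
    integral_congr_ae (by filter_upwards [huv] with x hx; rw [hx])
  have h2 : ∫ x in Ω, φ x * inner ℝ (H x) e = ∫ x in Ω, φ x * inner ℝ (G x) e :=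
    integral_congr_ae (by filter_upwards [hGH] with x hx; rw [hx])
  rw [h1, h2, h φ hφ e]

theorem memLp_of_continuous (hΩ : Bornology.IsBounded Ω) (hΩm : MeasurableSet Ω)
    {F : Type*} [NormedAddCommGroup F] [SecondCountableTopologyEither (Space d) F]
    {q : ℝ≥0∞} {f : Space d → F} (hf : Continuous f) : MemLp f q (volume.restrict Ω) := by
  have : IsFiniteMeasure (volume.restrict Ω) := ⟨by simpa using hΩ.measure_lt_top⟩
  obtain ⟨C, hC⟩ := hΩ.isCompact_closure.exists_bound_of_continuousOn hf.continuousOn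
  refine MemLp.of_bound hf.aestronglyMeasurable C ?_
  filter_upwards [ae_restrict_mem hΩm] with x hx
  exact hC x (subset_closure hx)

theorem continuous_gradient {h : Space d → ℝ} (hh : ContDiff ℝ 1 h) :
    Continuous (gradient h) :=
  (InnerProductSpace.toDual ℝ (Space d)).symm.continuous.comp (hh.continuous_fderiv (by simp))

/-- Restrictions of `C^1` functions to a bounded open set are Sobolev functions. -/
theorem exists_sobolev_of_contDiff (hΩo : IsOpen Ω) (hΩ : Bornology.IsBounded Ω)
    {h : Space d → ℝ} (hh : ContDiff ℝ 1 h) :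
    ∃ u : sobolev p Ω, toFun u =ᵐ[volume.restrict Ω] h
      ∧ grad u =ᵐ[volume.restrict Ω] gradient h := by
  have m1 : MemLp h p (volume.restrict Ω) := memLp_of_continuous hΩ hΩo.measurableSet hh.continuous
  have m2 : MemLp (gradient h) p (volume.restrict Ω) :=
    memLp_of_continuous hΩ hΩo.measurableSet (continuous_gradient hh)
  refine ⟨⟨(m1.toLp h, m2.toLp _), ?_⟩, m1.coeFn_toLp, m2.coeFn_toLp⟩
  exact (hasWeakGradient_gradient hh).congr m1.coeFn_toLp.symm m2.coeFn_toLp.symm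

/-- Uniqueness of weak gradients, by the fundamental lemma of the calculus of variations. It is
needed because `sobolevZero` and `traceOf` single out elements only through their underlying
functions. -/
theorem grad_eq_zero_of_toFun_eq_zero (hΩo : IsOpen Ω) {u : sobolev p Ω} (hu : toFun u = 0) :
    grad u = 0 := by
  have hint : ∀ φ : Space d → ℝ, IsTestFunction Ω φ →
      Integrable (fun x => φ x • grad u x) (volume.restrict Ω) := fun φ hφ =>
    ((Lp.memLp (grad u)).locallyIntegrable
      Fact.out).integrable_smul_left_of_hasCompactSupport hφ.smooth.continuous hφ.compact
  have hz : ∀ φ : Space d → ℝ, IsTestFunction Ω φ → ∫ x in Ω, φ x • grad u x = 0 := by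
    intro φ hφ
    refine ext_inner_left ℝ fun e => ?_
    rw [← integral_inner (hint φ hφ), inner_zero_right]
    have h := u.2 φ hφ e
    have h0 : ∫ x in Ω, fderiv ℝ φ x e * u.1.1 x = 0 := by
      refine integral_eq_zero_of_ae ?_
      have hu' : u.1.1 = 0 := hu
      rw [hu']
      filter_upwards [Lp.coeFn_zero ℝ p (volume.restrict Ω)] with x hx
      rw [hx]
      simp
    rw [h0] at h
    rw [← neg_eq_zero, h, neg_inj]
    refine integral_congr_ae (ae_of_all _ fun x => ?_)
    simp only [real_inner_smul_right, real_inner_comm e]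
    rfl
  have hae : ∀ᵐ x, x ∈ Ω → grad u x = 0 := by
    refine hΩo.ae_eq_zero_of_integral_contDiff_smul_eq_zero (μ := volume) ?_ ?_
    · have h1 : LocallyIntegrable (grad u) (volume.restrict Ω) :=
        (Lp.memLp (grad u)).locallyIntegrable Fact.out
      exact locallyIntegrableOn_of_locallyIntegrable_restrict h1
    · intro φ h1 h2 h3
      have hφ : IsTestFunction Ω φ := ⟨h1, h2, h3⟩
      rw [← setIntegral_eq_integral_of_forall_compl_eq_zero (s := Ω), hz φ hφ]
      intro x hx
      simp [hφ.eq_zero hx]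
  refine Lp.ext ?_
  rw [EventuallyEq, ae_restrict_iff' hΩo.measurableSet]
  filter_upwards [hae, (ae_restrict_iff' hΩo.measurableSet).1
    (Lp.coeFn_zero (Space d) p (volume.restrict Ω))] with x hx h0 hxΩ
  rw [hx hxΩ, h0 hxΩ]
  rfl

theorem grad_eq_of_toFun_eq (hΩo : IsOpen Ω) {u v : sobolev p Ω} (h : toFun u = toFun v) :
    grad u = grad v := by
  have h1 : toFun (u - v) = 0 := by
    change toFun u - toFun v = 0
    rw [h, sub_self]
  exact sub_eq_zero.1 (grad_eq_zero_of_toFun_eq_zero hΩo h1)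

theorem grad_ae_eq_gradient (hΩo : IsOpen Ω) (hΩ : Bornology.IsBounded Ω) {u : sobolev p Ω}
    {h : Space d → ℝ} (hh : ContDiff ℝ 1 h) (hu : toFun u =ᵐ[volume.restrict Ω] h) :
    grad u =ᵐ[volume.restrict Ω] gradient h := by
  obtain ⟨v, hv1, hv2⟩ := exists_sobolev_of_contDiff (p := p) hΩo hΩ hh
  rw [grad_eq_of_toFun_eq hΩo (Lp.ext (hu.trans hv1.symm))]
  exact hv2

theorem exists_traceOf_eq (hΩo : IsOpen Ω) (hΩ : Bornology.IsBounded Ω) {h : Space d → ℝ}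
    (hh : ContDiff ℝ 1 h) :
    ∃ u : sobolev p Ω, traceOf p Ω h = trace u ∧ grad u =ᵐ[volume.restrict Ω] gradient h := by
  have hex : ∃ u : sobolev p Ω, toFun u =ᵐ[volume.restrict Ω] h :=
    (exists_sobolev_of_contDiff hΩo hΩ hh).imp fun _ hu => hu.1
  refine ⟨hex.choose, ?_, grad_ae_eq_gradient hΩo hΩ hh hex.choose_spec⟩
  rw [traceOf, dif_pos hex]

/-- The gradient as a continuous linear map on `W^{1,p}(Ω)`. -/
def gradL : sobolev p Ω →L[ℝ] Lp (Space d) p (volume.restrict Ω) :=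
  (ContinuousLinearMap.snd ℝ _ _).comp (sobolev p Ω).subtypeL

/-- Each weak gradient identity equates two continuous functionals, given by pairing with compactly
supported continuous functions in the dual `L^q`. -/
theorem isClosed_sobolev : IsClosed (sobolev p Ω : Set
    (Lp ℝ p (volume.restrict Ω) × Lp (Space d) p (volume.restrict Ω))) := by
  have hc : ENNReal.HolderConjugate p (ENNReal.conjExponent p) := inferInstance
  have hc' : ENNReal.HolderConjugate (ENNReal.conjExponent p) p := hc.symm
  have : Fact (1 ≤ ENNReal.conjExponent p) := ⟨by simp [ENNReal.conjExponent]⟩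
  have hset : (sobolev p Ω : Set
      (Lp ℝ p (volume.restrict Ω) × Lp (Space d) p (volume.restrict Ω)))
      = ⋂ (φ : Space d → ℝ) (_ : IsTestFunction Ω φ) (e : Space d),
        {f | ∫ x in Ω, fderiv ℝ φ x e * f.1 x = - ∫ x in Ω, φ x * inner ℝ (f.2 x) e} := by
    ext f
    simp only [Set.mem_iInter]
    rfl
  rw [hset]
  refine isClosed_iInter fun φ => isClosed_iInter fun hφ => isClosed_iInter fun e => ?_
  have m1 : MemLp (fun x => fderiv ℝ φ x e) (ENNReal.conjExponent p) (volume.restrict Ω) :=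
    (hφ.continuous_fderiv_apply e).memLp_of_hasCompactSupport (hφ.compact.fderiv_apply ℝ e)
  have m2 : MemLp (fun x => φ x • e) (ENNReal.conjExponent p) (volume.restrict Ω) :=
    (hφ.smooth.continuous.smul continuous_const).memLp_of_hasCompactSupport
      hφ.compact.smul_right
  have e1 : ∀ f : Lp ℝ p (volume.restrict Ω), ∫ x in Ω, fderiv ℝ φ x e * f x
      = (ContinuousLinearMap.mul ℝ ℝ).lpPairing (volume.restrict Ω) (ENNReal.conjExponent p) p
        (m1.toLp _) f := fun f => by
    rw [ContinuousLinearMap.lpPairing_eq_integral]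
    refine integral_congr_ae ?_
    filter_upwards [m1.coeFn_toLp] with x hx
    rw [hx, ContinuousLinearMap.mul_apply']
  have e2 : ∀ f : Lp (Space d) p (volume.restrict Ω), ∫ x in Ω, φ x * inner ℝ (f x) e
      = (innerSL ℝ : Space d →L[ℝ] Space d →L[ℝ] ℝ).lpPairing (volume.restrict Ω)
        (ENNReal.conjExponent p) p (m2.toLp _) f := fun f => by
    rw [ContinuousLinearMap.lpPairing_eq_integral]
    refine integral_congr_ae ?_
    filter_upwards [m2.coeFn_toLp] with x hx
    rw [hx, innerSL_apply_apply, real_inner_smul_left, real_inner_comm]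
  simp only [e1, e2]
  exact isClosed_eq (by fun_prop) (by fun_prop)

instance : CompleteSpace (sobolev p Ω) := isClosed_sobolev.completeSpace_coe

theorem isClosed_sobolevZero : IsClosed (sobolevZero p Ω : Set (sobolev p Ω)) :=
  Submodule.isClosed_topologicalClosure _

theorem IsTestFunction.add {φ ψ : Space d → ℝ} (hφ : IsTestFunction Ω φ)
    (hψ : IsTestFunction Ω ψ) : IsTestFunction Ω (φ + ψ) :=
  ⟨hφ.smooth.add hψ.smooth, hφ.compact.add hψ.compact,
    (tsupport_add φ ψ).trans (Set.union_subset hφ.support hψ.support)⟩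

theorem IsTestFunction.const_smul {φ : Space d → ℝ} (hφ : IsTestFunction Ω φ) (c : ℝ) :
    IsTestFunction Ω (c • φ) :=
  ⟨hφ.smooth.const_smul c, hφ.compact.smul_left (f := fun _ => c),
    (tsupport_smul_subset_right (fun _ => c) φ).trans hφ.support⟩

theorem isTestFunction_zero : IsTestFunction Ω (0 : Space d → ℝ) :=
  ⟨contDiff_const, HasCompactSupport.zero, by simp [tsupport]⟩

/-- A closed condition on Sobolev functions holds on `W^{1,p}_0` if it holds for test
functions. -/
theorem sobolevZero_induction {C : Set (sobolev p Ω)} (hC : IsClosed C)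
    (h : ∀ u : sobolev p Ω, ∀ φ, IsTestFunction Ω φ → toFun u =ᵐ[volume.restrict Ω] φ → u ∈ C)
    {u : sobolev p Ω} (hu : u ∈ sobolevZero p Ω) : u ∈ C := by
  refine closure_minimal (fun v hv => ?_) hC hu
  -- Test functions are closed under linear combinations, so the span adds nothing before the
  -- closure is taken.
  have : ∃ φ, IsTestFunction Ω φ ∧ toFun v =ᵐ[volume.restrict Ω] φ := by
    refine Submodule.span_induction (fun x hx => hx) ?_ ?_ ?_ hv
    · exact ⟨0, isTestFunction_zero, Lp.coeFn_zero ℝ p (volume.restrict Ω)⟩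
    · rintro x y - - ⟨φ, hφ, hx⟩ ⟨ψ, hψ, hy⟩
      exact ⟨φ + ψ, hφ.add hψ, (Lp.coeFn_add (toFun x) (toFun y)).trans (hx.add hy)⟩
    · rintro c x - ⟨φ, hφ, hx⟩
      exact ⟨c • φ, hφ.const_smul c, (Lp.coeFn_smul c (toFun x)).trans (hx.const_smul c)⟩
  obtain ⟨φ, hφ, hv'⟩ := this
  exact h v φ hφ hv'

end Sobolev

/-! ### The Poincaré inequality -/

section Poincare

variable {d : ℕ} {Ω : Set (Space d)}

/-- The Poincaré inequality for test functions. -/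
theorem exists_integral_rpow_le (hd : 1 ≤ d) (hΩo : IsOpen Ω) (hΩ : Bornology.IsBounded Ω)
    {P : ℝ} (hP : 1 < P) :
    ∃ C : ℝ, 0 ≤ C ∧ ∀ φ, IsTestFunction Ω φ →
      ∫ x in Ω, ‖φ x‖ ^ P ≤ C * ∫ x in Ω, ‖gradient φ x‖ ^ P := by
  have hP0 : 0 < P := by linarith
  have hP1 : 0 < P - 1 := by linarith
  obtain ⟨R, hR0, hR⟩ := hΩ.exists_pos_norm_le
  let e : Space d := EuclideanSpace.single ⟨0, hd⟩ 1
  have he : ‖e‖ = 1 := by simp [e]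
  -- This weight gives the term `|φ|^P` in Young's inequality the coefficient `1/2`, so that it can
  -- be absorbed on the left.
  let s : ℝ := (2 * (P - 1)) ^ (P - 1)
  have hs : 0 < s := by positivity
  have hs' : (P - 1) * s ^ (-1 / (P - 1)) = 1 / 2 := by
    rw [← Real.rpow_mul (by positivity), mul_div_cancel₀ _ hP1.ne', Real.rpow_neg_one]
    field_simp
  refine ⟨2 * (s * R ^ P), by positivity, fun φ hφ => ?_⟩
  have hφ1 : ContDiff ℝ 1 φ := hφ.smooth.of_le (by simp)
  have hφd : Differentiable ℝ φ := hφ1.differentiable (by simp)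
  let ψ : Space d → ℝ := fun x => ‖φ x‖ ^ P
  have hψ1 : ContDiff ℝ 1 ψ := hφ1.norm_rpow hP
  have hψc : HasCompactSupport ψ :=
    hφ.compact.comp_left (g := fun y : ℝ => ‖y‖ ^ P) (by simp [hP0.ne'])
  have hlin : ContDiff ℝ 1 fun x : Space d => inner ℝ e x := contDiff_const.inner ℝ contDiff_id
  -- Since `e · x` has derivative one along `e`, integrating by parts moves that derivative to
  -- `|φ|^P`, at the cost of the factor `e · x`, bounded by `R` on `Ω`.
  have hibp := integral_fderiv_mul_eq hψ1 hψc hlin e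
  have hfd : ∀ x, fderiv ℝ (fun x : Space d => inner ℝ e x) x e = 1 := fun x => by
    have : (fun x : Space d => inner ℝ e x) = innerSL ℝ e := rfl
    rw [this, ContinuousLinearMap.fderiv, innerSL_apply_apply, real_inner_self_eq_norm_sq, he]
    norm_num
  simp only [hfd, mul_one] at hibp
  have hgn : ∀ x, ‖gradient φ x‖ = ‖fderiv ℝ φ x‖ := fun x => by
    rw [gradient, LinearIsometryEquiv.norm_map]
  have hcg : Continuous fun x => ‖gradient φ x‖ ^ P :=
    (continuous_gradient hφ1).norm.rpow_const fun _ => Or.inr hP0.le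
  have hcψ : Continuous ψ := hψ1.continuous
  have hin : ∀ f : Space d → ℝ, Continuous f → Integrable f (volume.restrict Ω) := fun f hf =>
    memLp_one_iff_integrable.1 (memLp_of_continuous hΩ hΩo.measurableSet hf)
  have hpt : ∀ x ∈ Ω, -(fderiv ℝ ψ x e * inner ℝ e x)
      ≤ s * R ^ P * ‖gradient φ x‖ ^ P + 1 / 2 * ψ x := fun x hx => by
    have h1 : |fderiv ℝ ψ x e| ≤ P * ‖φ x‖ ^ (P - 1) * ‖fderiv ℝ φ x‖ := by
      have := (fderiv ℝ ψ x).le_opNorm e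
      rw [he, mul_one, Real.norm_eq_abs] at this
      exact this.trans (norm_fderiv_norm_rpow_le hφd hP)
    have h2 : |inner ℝ e x| ≤ R := by
      have := abs_real_inner_le_norm e x
      rw [he, one_mul] at this
      exact this.trans (hR x hx)
    calc _ ≤ |fderiv ℝ ψ x e * inner ℝ e x| := neg_le_abs _
      _ = |fderiv ℝ ψ x e| * |inner ℝ e x| := abs_mul _ _
      _ ≤ P * ‖φ x‖ ^ (P - 1) * ‖fderiv ℝ φ x‖ * R := by gcongr
      _ = P * (‖φ x‖ ^ (P - 1) * (R * ‖gradient φ x‖)) := by rw [hgn]; ring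
      _ ≤ _ := young_weighted hP hs (norm_nonneg _) (by positivity)
      _ = _ := by
        rw [hs', Real.mul_rpow hR0.le (norm_nonneg _)]
        ring
  have key : ∫ x in Ω, ψ x ≤ s * R ^ P * (∫ x in Ω, ‖gradient φ x‖ ^ P)
      + 1 / 2 * ∫ x in Ω, ψ x := by
    have h1 : ∫ x in Ω, ψ x = ∫ x in Ω, -(fderiv ℝ ψ x e * inner ℝ e x) := by
      rw [integral_neg, setIntegral_eq_integral_of_forall_compl_eq_zero,
        setIntegral_eq_integral_of_forall_compl_eq_zero, hibp, neg_neg]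
      · intro x hx
        rw [show fderiv ℝ ψ x = _ from hφd.fderiv_norm_rpow hP, hφ.eq_zero hx]
        simp
      · intro x hx
        simp [ψ, hφ.eq_zero hx, hP0.ne']
    nth_rewrite 1 [h1]
    rw [← integral_const_mul, ← integral_const_mul, ← integral_add]
    · refine setIntegral_mono_on (hin _ ?_) (hin _ ?_) hΩo.measurableSet hpt
      · exact (((hψ1.continuous_fderiv (by simp)).clm_apply continuous_const).mul
          hlin.continuous).neg
      · fun_prop
    · exact hin _ (by fun_prop)
    · exact hin _ (by fun_prop)
  have hψint : ∫ x in Ω, ψ x = ∫ x in Ω, ‖φ x‖ ^ P := rfl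
  rw [← hψint]
  linarith

variable {p : ℝ≥0∞} [Fact (1 ≤ p)]

/-- The Poincaré inequality on `W^{1,p}_0`. -/
theorem exists_norm_le_norm_grad (hd : 1 ≤ d) (hp₁ : 1 < p) (hp : p ≠ ⊤) (hΩo : IsOpen Ω)
    (hΩ : Bornology.IsBounded Ω) :
    ∃ C : ℝ, 0 ≤ C ∧ ∀ u ∈ sobolevZero p Ω, ‖u‖ ≤ C * ‖grad u‖ := by
  have hP := one_lt_toReal hp₁ hp
  have hP0 : 0 < p.toReal := by linarith
  obtain ⟨C, hC0, hC⟩ := exists_integral_rpow_le hd hΩo hΩ hP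
  refine ⟨max (C ^ p.toReal⁻¹) 1, by positivity, fun u hu => ?_⟩
  let S : Set (sobolev p Ω) := {u | ‖u‖ ≤ max (C ^ p.toReal⁻¹) 1 * ‖grad u‖}
  have hS : IsClosed S :=
    isClosed_le continuous_norm (continuous_const.mul (gradL (p := p) (Ω := Ω)).continuous.norm)
  refine sobolevZero_induction hS (fun v φ hφ hv => ?_) hu
  have hg := grad_ae_eq_gradient hΩo hΩ (hφ.smooth.of_le (by simp)) hv
  have h1 : ‖toFun v‖ ^ p.toReal ≤ C * ‖grad v‖ ^ p.toReal := by
    rw [Lp_norm_rpow_eq hp₁ hp, Lp_norm_rpow_eq hp₁ hp]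
    have e1 : ∫ x in Ω, ‖toFun v x‖ ^ p.toReal = ∫ x in Ω, ‖φ x‖ ^ p.toReal :=
      integral_congr_ae (by filter_upwards [hv] with x hx; rw [hx])
    have e2 : ∫ x in Ω, ‖grad v x‖ ^ p.toReal = ∫ x in Ω, ‖gradient φ x‖ ^ p.toReal :=
      integral_congr_ae (by filter_upwards [hg] with x hx; rw [hx])
    rw [e1, e2]
    exact hC φ hφ
  have h2 : ‖toFun v‖ ≤ C ^ p.toReal⁻¹ * ‖grad v‖ := by
    refine (Real.rpow_le_rpow_iff (norm_nonneg _) (by positivity) hP0).1 ?_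
    rwa [Real.mul_rpow (by positivity) (norm_nonneg _), ← Real.rpow_mul hC0,
      inv_mul_cancel₀ hP0.ne', Real.rpow_one]
  change max ‖toFun v‖ ‖grad v‖ ≤ _
  refine max_le (h2.trans ?_) ?_
  · gcongr
    exact le_max_left _ _
  · exact le_mul_of_one_le_left (norm_nonneg _) (le_max_right _ _)

/-- By Poincaré the gradient is antilipschitz on the complete space `W^{1,p}_0`. Closedness of its
image lets the minimization take place among gradients in `L^p`. -/
theorem isClosed_map_gradL (hd : 1 ≤ d) (hp₁ : 1 < p) (hp : p ≠ ⊤) (hΩo : IsOpen Ω)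
    (hΩ : Bornology.IsBounded Ω) :
    IsClosed (((sobolevZero p Ω).map (gradL (p := p) (Ω := Ω)).toLinearMap :
      Submodule ℝ _) : Set (Lp (Space d) p (volume.restrict Ω))) := by
  obtain ⟨C, hC0, hC⟩ := exists_norm_le_norm_grad hd hp₁ hp hΩo hΩ
  have : CompleteSpace (sobolevZero p Ω) := isClosed_sobolevZero.completeSpace_coe
  let T : sobolevZero p Ω → Lp (Space d) p (volume.restrict Ω) := fun u => grad u.1
  have hT : AntilipschitzWith ⟨C, hC0⟩ T := by
    refine AntilipschitzWith.of_le_mul_dist fun u v => ?_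
    rw [Subtype.dist_eq, dist_eq_norm, dist_eq_norm]
    exact hC (u.1 - v.1) (Submodule.sub_mem _ u.2 v.2)
  have hTc : UniformContinuous T :=
    (gradL (p := p) (Ω := Ω)).uniformContinuous.comp uniformContinuous_subtype_val
  convert hT.isClosed_range hTc using 1
  ext G
  constructor
  · rintro ⟨u, hu, rfl⟩
    exact ⟨⟨u, hu⟩, rfl⟩
  · rintro ⟨u, rfl⟩
    exact ⟨u.1, u.2, rfl⟩

end Poincare

/-! ### Minimizers and the Dirichlet-to-Neumann map -/

section DNMap

variable {d : ℕ} {Ω : Set (Space d)} {p : ℝ≥0∞} [Fact (1 ≤ p)] {σ : Space d → ℝ}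

theorem energy_eq (u : sobolev p Ω) : energy σ u = lpEnergy σ (grad u) := rfl

theorem fluxPairing_eq (u v : sobolev p Ω) : fluxPairing σ u v = lpFlux σ (grad u) (grad v) := rfl

theorem grad_add (u v : sobolev p Ω) : grad (u + v) = grad u + grad v := rfl

theorem grad_sub (u v : sobolev p Ω) : grad (u - v) = grad u - grad v := rfl

theorem grad_smul (c : ℝ) (u : sobolev p Ω) : grad (c • u) = c • grad u := rfl

theorem trace_eq_iff {u v : sobolev p Ω} : trace u = trace v ↔ u - v ∈ sobolevZero p Ω :=
  Submodule.Quotient.eq _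

theorem exists_isMinimizer (hd : 1 ≤ d) (hp₁ : 1 < p) (hp : p ≠ ⊤) (hΩo : IsOpen Ω)
    (hΩ : Bornology.IsBounded Ω) (hσ : IsElliptic σ) (f : BoundaryValues p Ω) :
    ∃ u : sobolev p Ω, trace u = f ∧ IsMinimizer σ u := by
  obtain ⟨u, hu⟩ := (sobolevZero p Ω).mkQ_surjective f
  obtain ⟨_, ⟨h, hh, rfl⟩, hmin⟩ := exists_lpEnergy_minimizer hp₁ hp hσ _
    (isClosed_map_gradL hd hp₁ hp hΩo hΩ) (grad u)
  have htr : trace (u + h) = trace u := trace_eq_iff.2 (by simpa using hh)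
  refine ⟨u + h, htr.trans hu, fun v hv => ?_⟩
  have hv' : v - u ∈ sobolevZero p Ω := trace_eq_iff.1 (hv.trans htr)
  have := hmin _ ⟨v - u, hv', rfl⟩
  rw [energy_eq, energy_eq, grad_add]
  refine this.trans_eq ?_
  change lpEnergy σ (grad u + (grad v - grad u)) = _
  rw [add_sub_cancel]

theorem IsMinimizer.fluxPairing_eq_zero (hp₁ : 1 < p) (hp : p ≠ ⊤) (hσ : IsElliptic σ)
    {u v : sobolev p Ω} (hu : IsMinimizer σ u) (hv : v ∈ sobolevZero p Ω) :
    fluxPairing σ u v = 0 := by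
  rw [fluxPairing_eq]
  refine lpFlux_eq_zero_of_le hp₁ hp hσ fun t => ?_
  rw [← grad_smul, ← grad_add]
  exact hu _ (trace_eq_iff.2 (by simpa using Submodule.smul_mem _ t hv))

/-- The midpoint has the same boundary values, so it competes with both. Uniqueness of the gradient
makes the flux independent of the minimizer. -/
theorem IsMinimizer.grad_eq (hp₁ : 1 < p) (hp : p ≠ ⊤) (hσ : IsElliptic σ)
    {u v : sobolev p Ω} (hu : IsMinimizer σ u) (hv : IsMinimizer σ v) (h : trace u = trace v) :
    grad u = grad v := by
  have h1 : trace ((1 / 2 : ℝ) • (u + v)) = trace u := by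
    rw [trace_eq_iff]
    have : (1 / 2 : ℝ) • (u + v) - u = (-(1 / 2) : ℝ) • (u - v) := by module
    rw [this]
    exact Submodule.smul_mem _ _ (trace_eq_iff.1 h)
  have h2 := hu _ h1
  have h3 := hv _ (h1.trans h)
  rw [energy_eq, energy_eq, grad_smul, grad_add] at h2 h3
  exact eq_of_lpEnergy_le_midpoint hp₁ hp hσ h2 h3

/-- By convexity the weak equation is also sufficient; this identifies Wolff solutions as background
minimizers. -/
theorem isMinimizer_of_fluxPairing_eq_zero (hp₁ : 1 < p) (hp : p ≠ ⊤) (hσ : IsElliptic σ)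
    {u : sobolev p Ω} (hu : ∀ v ∈ sobolevZero p Ω, fluxPairing σ u v = 0) :
    IsMinimizer σ u := fun v hv => by
  have h := lpEnergy_le_add_lpFlux hp₁ hp hσ (grad u) (grad v)
  rw [← grad_sub, ← fluxPairing_eq, hu _ (trace_eq_iff.1 hv.symm)] at h
  rw [energy_eq, energy_eq]
  linarith

theorem fluxPairing_add_right (hp₁ : 1 < p) (hp : p ≠ ⊤) (hσ : IsElliptic σ)
    (u v v' : sobolev p Ω) :
    fluxPairing σ u (v + v') = fluxPairing σ u v + fluxPairing σ u v' := by
  obtain ⟨L, hL⟩ := exists_clm_eq_lpFlux hp₁ hp hσ (grad u)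
  simp only [fluxPairing_eq, ← hL, grad_add, map_add]

/-- The Dirichlet-to-Neumann map is well defined. -/
theorem isDNMap_dnMap (hd : 1 ≤ d) (hp₁ : 1 < p) (hp : p ≠ ⊤) (hΩo : IsOpen Ω)
    (hΩ : Bornology.IsBounded Ω) (hσ : IsElliptic σ) : IsDNMap σ (dnMap p Ω σ) := by
  have hex : ∃ Λ : BoundaryValues p Ω → StrongDual ℝ (BoundaryValues p Ω), IsDNMap σ Λ := by
    have hmin := exists_isMinimizer (p := p) hd hp₁ hp hΩo hΩ hσ
    choose U hU hUmin using hmin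
    have hclm := fun f => exists_clm_eq_lpFlux hp₁ hp hσ (grad (U f))
    choose L hL using hclm
    -- The Euler-Lagrange equation is what lets the flux functional descend to the quotient.
    have hker : ∀ f, sobolevZero p Ω ≤ ((L f).comp gradL).ker := fun f v hv => by
      rw [LinearMap.mem_ker]
      change L f (grad v) = 0
      rw [hL]
      exact (hUmin f).fluxPairing_eq_zero hp₁ hp hσ hv
    refine ⟨fun f => (sobolevZero p Ω).liftQL ((L f).comp gradL) (hker f),
      fun f => ⟨U f, hU f, hUmin f⟩, fun u v hu => ?_⟩
    change L (trace u) (grad v) = _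
    rw [hL, fluxPairing_eq, (hUmin _).grad_eq hp₁ hp hσ hu (hU _)]
  rw [dnMap, dif_pos hex]
  exact hex.choose_spec

end DNMap

/-! ### Existence of Wolff functions -/

section Existence

variable {P : ℝ}

/-- A primitive of `(P - 1) sin² + cos²`. -/
def wolffPhase (P θ : ℝ) : ℝ := P / 2 * θ + (2 - P) / 4 * Real.sin (2 * θ)

/-- The derivative of the phase. -/
def wolffDensity (P θ : ℝ) : ℝ := (P - 1) * Real.sin θ ^ 2 + Real.cos θ ^ 2

theorem wolffDensity_pos (hP : 1 < P) (θ : ℝ) : 0 < wolffDensity P θ := by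
  have h := Real.sin_sq_add_cos_sq θ
  have h1 : 0 < P - 1 := by linarith
  rw [wolffDensity]
  rcases eq_or_ne (Real.cos θ) 0 with hc | hc
  · rw [hc] at h ⊢
    nlinarith
  · positivity

theorem hasDerivAt_wolffPhase (P θ : ℝ) :
    HasDerivAt (wolffPhase P) (wolffDensity P θ) θ := by
  have h1 : HasDerivAt (fun θ : ℝ => Real.sin (2 * θ)) (Real.cos (2 * θ) * 2) θ := by
    simpa using ((hasDerivAt_id θ).const_mul (2 : ℝ)).sin
  have h := ((hasDerivAt_id θ).const_mul (P / 2)).add (h1.const_mul ((2 - P) / 4))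
  refine h.congr_deriv ?_
  rw [wolffDensity, Real.sin_sq, Real.cos_two_mul]
  ring

theorem contDiff_wolffPhase (P : ℝ) : ContDiff ℝ ∞ (wolffPhase P) :=
  (contDiff_const.mul contDiff_id).add
    (contDiff_const.mul (Real.contDiff_sin.comp (contDiff_const.mul contDiff_id)))

theorem strictMono_wolffPhase (hP : 1 < P) : StrictMono (wolffPhase P) :=
  strictMono_of_hasDerivAt_pos (hasDerivAt_wolffPhase P) (wolffDensity_pos hP)

theorem surjective_wolffPhase (hP : 1 < P) : Function.Surjective (wolffPhase P) := by
  have hb : ∀ θ, |(2 - P) / 4 * Real.sin (2 * θ)| ≤ |(2 - P) / 4| := fun θ => by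
    rw [abs_mul]
    exact mul_le_of_le_one_right (abs_nonneg _) (Real.abs_sin_le_one _)
  have hP2 : 0 < P / 2 := by linarith
  refine (contDiff_wolffPhase P).continuous.surjective ?_ ?_
  · refine tendsto_atTop_add_right_of_le _ (-|(2 - P) / 4|) (tendsto_id.const_mul_atTop hP2)
      fun θ => (abs_le.1 (hb θ)).1
  · refine tendsto_atBot_add_right_of_ge _ (|(2 - P) / 4|) (tendsto_id.const_mul_atBot hP2)
      fun θ => (abs_le.1 (hb θ)).2

/-- The phase as a homeomorphism of the line. -/
def wolffPhaseHomeo (hP : 1 < P) : ℝ ≃ₜ ℝ :=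
  ((strictMono_wolffPhase hP).orderIsoOfSurjective _ (surjective_wolffPhase hP)).toHomeomorph

/-- The angle equation is separable: it says that the phase of `θ(s)` is affine in `s`. Inverting
the phase gives a global smooth solution. -/
theorem exists_wolffAngle (hP : 1 < P) : ∃ θ : ℝ → ℝ, ContDiff ℝ ∞ θ ∧
    ∀ s, HasDerivAt θ (-(P - 1) / wolffDensity P (θ s)) s := by
  let Φ := wolffPhaseHomeo hP
  have hΦ : ∀ θ, HasDerivAt Φ (wolffDensity P θ) θ := hasDerivAt_wolffPhase P
  have h1 : ContDiff ℝ ∞ Φ.symm :=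
    Φ.contDiff_symm_deriv (fun θ => (wolffDensity_pos hP θ).ne') hΦ (contDiff_wolffPhase P)
  have h2 : ∀ y, HasDerivAt Φ.symm (wolffDensity P (Φ.symm y))⁻¹ y := fun y =>
    HasDerivAt.of_local_left_inverse Φ.symm.continuous.continuousAt (hΦ _)
      (wolffDensity_pos hP _).ne' (Eventually.of_forall Φ.apply_symm_apply)
  refine ⟨fun s => Φ.symm (-(P - 1) * s), h1.comp (contDiff_const.mul contDiff_id), fun s => ?_⟩
  have h3 : HasDerivAt (fun s : ℝ => -(P - 1) * s) (-(P - 1)) s := by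
    simpa using (hasDerivAt_id s).const_mul (-(P - 1))
  refine ((h2 _).comp s h3).congr_deriv ?_
  rw [div_eq_inv_mul]

/-- Wolff functions exist. -/
theorem exists_isWolffFunction (hP : 1 < P) : ∃ w : ℝ → ℝ, IsWolffFunction P w := by
  obtain ⟨θ, hθ, hθ'⟩ := exists_wolffAngle hP
  have hP1 : P - 1 ≠ 0 := by linarith
  -- With `w = R cos θ` and `w' = R sin θ`, the first integral of the equation is `log R + k sin²
  -- θ`; its value is normalized to zero.
  set k : ℝ := (2 - P) / (2 * (P - 1)) with hk
  let R : ℝ → ℝ := fun s => Real.exp (-k * Real.sin (θ s) ^ 2)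
  have hR : ∀ s, HasDerivAt R (R s * (-k * (2 * Real.sin (θ s) *
      (Real.cos (θ s) * (-(P - 1) / wolffDensity P (θ s)))))) s := fun s => by
    refine ((((hθ' s).sin.pow 2).const_mul (-k)).exp).congr_deriv ?_
    simp [R]
  have hN : ∀ s, wolffDensity P (θ s) ≠ 0 := fun s => (wolffDensity_pos hP _).ne'
  have hw : ∀ s, HasDerivAt (fun s => R s * Real.cos (θ s)) (R s * Real.sin (θ s)) s := fun s => by
    refine ((hR s).mul (hθ' s).cos).congr_deriv ?_
    have h := hN s
    rw [hk]
    field_simp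
    rw [wolffDensity, Real.cos_sq']
    ring
  have hw' : ∀ s, HasDerivAt (fun s => R s * Real.sin (θ s))
      (-(R s * Real.cos (θ s) * ((P - 1 - (2 - P) * Real.sin (θ s) ^ 2)
        / wolffDensity P (θ s)))) s := fun s => by
    refine ((hR s).mul (hθ' s).sin).congr_deriv ?_
    have h := hN s
    rw [hk]
    field_simp
    ring
  have hd : deriv (fun s => R s * Real.cos (θ s)) = fun s => R s * Real.sin (θ s) :=
    funext fun s => (hw s).deriv
  refine ⟨fun s => R s * Real.cos (θ s), ?_, fun s => ?_, ?_⟩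
  · exact (Real.contDiff_exp.comp (contDiff_const.mul ((Real.contDiff_sin.comp hθ).pow 2))).mul
      (Real.contDiff_cos.comp hθ)
  · rw [hd, (hw' s).deriv]
    have hR0 : R s ≠ 0 := (Real.exp_pos _).ne'
    have hV : wolffV P (R s * Real.cos (θ s)) (R s * Real.sin (θ s))
        = (P - 1 - (2 - P) * Real.sin (θ s) ^ 2) / wolffDensity P (θ s) := by
      have e1 : (P - 1) * (R s * Real.sin (θ s)) ^ 2 + (R s * Real.cos (θ s)) ^ 2
          = R s ^ 2 * wolffDensity P (θ s) := by rw [wolffDensity]; ring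
      have e2 : (2 * P - 3) * (R s * Real.sin (θ s)) ^ 2 + (P - 1) * (R s * Real.cos (θ s)) ^ 2
          = R s ^ 2 * (P - 1 - (2 - P) * Real.sin (θ s) ^ 2) := by
        rw [mul_pow, mul_pow, Real.cos_sq']; ring
      rw [wolffV, e1, e2, mul_div_mul_left _ _ (pow_ne_zero 2 hR0)]
    rw [hV]
    ring
  · rw [hd]
    by_contra! h
    have hR0 : R 0 ≠ 0 := (Real.exp_pos _).ne'
    have h1 : Real.cos (θ 0) = 0 := by simpa [hR0] using h.1
    have h2 : Real.sin (θ 0) = 0 := by simpa [hR0] using h.2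
    simpa [h1, h2] using Real.sin_sq_add_cos_sq (θ 0)

end Existence

/-! ### Bounds for arbitrary Wolff functions -/

section WolffFunction

variable {P : ℝ} {w : ℝ → ℝ}

/-- The squared modulus `w² + w'²`. -/
def wolffModulus (w : ℝ → ℝ) (s : ℝ) : ℝ := w s ^ 2 + deriv w s ^ 2

theorem IsWolffFunction.contDiff_deriv (hw : IsWolffFunction P w) : ContDiff ℝ ∞ (deriv w) :=
  (contDiff_infty_iff_deriv.1 hw.smooth).2

theorem IsWolffFunction.hasDerivAt (hw : IsWolffFunction P w) (s : ℝ) :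
    HasDerivAt w (deriv w s) s :=
  (hw.smooth.differentiable (by simp) s).hasDerivAt

theorem IsWolffFunction.hasDerivAt_deriv (hw : IsWolffFunction P w) (s : ℝ) :
    HasDerivAt (deriv w) (-(wolffV P (w s) (deriv w s) * w s)) s := by
  have h := (hw.contDiff_deriv.differentiable (by simp) s).hasDerivAt
  rwa [eq_neg_of_add_eq_zero_left (hw.ode s)] at h

theorem IsWolffFunction.contDiff_modulus (hw : IsWolffFunction P w) :
    ContDiff ℝ ∞ (wolffModulus w) :=
  (hw.smooth.pow 2).add (hw.contDiff_deriv.pow 2)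

theorem IsWolffFunction.hasDerivAt_modulus (hw : IsWolffFunction P w) (s : ℝ) :
    HasDerivAt (wolffModulus w)
      (2 * w s * deriv w s * (1 - wolffV P (w s) (deriv w s))) s := by
  refine (((hw.hasDerivAt s).pow 2).add ((hw.hasDerivAt_deriv s).pow 2)).congr_deriv ?_
  push_cast
  ring

/-- Each term of the numerator is dominated by a multiple of the denominator. At the origin the
quotient is `0 / 0 = 0`, so the bound can be used before the modulus is known to be positive. -/
theorem abs_wolffV_le (hP : 1 < P) (a b : ℝ) :
    |wolffV P a b| ≤ |2 * P - 3| / (P - 1) + (P - 1) := by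
  have hP1 : 0 < P - 1 := by linarith
  have hM : 0 ≤ |2 * P - 3| / (P - 1) + (P - 1) := by positivity
  have hN : 0 ≤ (P - 1) * b ^ 2 + a ^ 2 := by positivity
  rw [wolffV, abs_div, abs_of_nonneg hN]
  refine div_le_of_le_mul₀ hN hM ?_
  calc |(2 * P - 3) * b ^ 2 + (P - 1) * a ^ 2|
      ≤ |(2 * P - 3) * b ^ 2| + |(P - 1) * a ^ 2| := abs_add_le _ _
    _ = |2 * P - 3| * b ^ 2 + (P - 1) * a ^ 2 := by
      rw [abs_mul, abs_mul, abs_of_nonneg (sq_nonneg a), abs_of_nonneg (sq_nonneg b),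
        abs_of_pos hP1]
    _ = |2 * P - 3| / (P - 1) * ((P - 1) * b ^ 2) + (P - 1) * a ^ 2 := by field_simp
    _ ≤ |2 * P - 3| / (P - 1) * ((P - 1) * b ^ 2 + a ^ 2)
        + (P - 1) * ((P - 1) * b ^ 2 + a ^ 2) := by
      gcongr
      · exact le_add_of_nonneg_right (sq_nonneg a)
      · exact le_add_of_nonneg_left (by positivity)
    _ = _ := by ring

/-- A nonnegative function with `|E'| ≤ K E` that is positive at one point is positive. -/
theorem pos_of_abs_deriv_le {E E' : ℝ → ℝ} {K : ℝ} (hE : ∀ s, HasDerivAt E (E' s) s)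
    (hK : ∀ s, |E' s| ≤ K * E s) (h0 : 0 < E 0) (s : ℝ) : 0 < E s := by
  have hexp : ∀ c s : ℝ, HasDerivAt (fun s => E s * Real.exp (c * s))
      ((E' s + c * E s) * Real.exp (c * s)) s := fun c s => by
    have h1 : HasDerivAt (fun s : ℝ => c * s) c s := by
      simpa using (hasDerivAt_id s).const_mul c
    refine ((hE s).mul h1.exp).congr_deriv ?_
    ring
  rcases le_total 0 s with hs | hs
  · have hm : Monotone fun s => E s * Real.exp (K * s) :=
      monotone_of_hasDerivAt_nonneg (hexp K) fun s =>
        mul_nonneg (by linarith [(abs_le.1 (hK s)).1]) (Real.exp_pos _).le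
    have h := hm hs
    simp only [mul_zero, Real.exp_zero, mul_one] at h
    exact pos_of_mul_pos_left (h0.trans_le h) (Real.exp_pos _).le
  · have hm : Antitone fun s => E s * Real.exp (-K * s) :=
      antitone_of_hasDerivAt_nonpos (hexp (-K)) fun s =>
        mul_nonpos_of_nonpos_of_nonneg (by linarith [(abs_le.1 (hK s)).2]) (Real.exp_pos _).le
    have h := hm hs
    simp only [mul_zero, Real.exp_zero, mul_one] at h
    exact pos_of_mul_pos_left (h0.trans_le h) (Real.exp_pos _).le

/-- Boundedness of `V` gives `|E'| ≤ K E` for the modulus `E`, so by Grönwall a nontrivial solution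
never reaches the origin, where `V` is singular. -/
theorem IsWolffFunction.modulus_pos (hP : 1 < P) (hw : IsWolffFunction P w) (s : ℝ) :
    0 < wolffModulus w s := by
  refine pos_of_abs_deriv_le (K := 1 + (|2 * P - 3| / (P - 1) + (P - 1)))
    hw.hasDerivAt_modulus (fun s => ?_) ?_ s
  · have h1 := abs_wolffV_le hP (w s) (deriv w s)
    have h2 : |1 - wolffV P (w s) (deriv w s)| ≤ 1 + (|2 * P - 3| / (P - 1) + (P - 1)) :=
      (abs_sub _ _).trans (by rw [abs_one]; linarith)
    have h3 : |2 * w s * deriv w s| ≤ wolffModulus w s := by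
      rw [wolffModulus, abs_le]
      constructor <;> nlinarith [sq_nonneg (w s + deriv w s), sq_nonneg (w s - deriv w s)]
    rw [abs_mul, mul_comm]
    gcongr
  · rw [wolffModulus]
    rcases hw.nontrivial with h | h
    · positivity
    · positivity

theorem wolff_denom_pos (hP : 1 < P) {a b : ℝ} (h : 0 < a ^ 2 + b ^ 2) :
    0 < (P - 1) * b ^ 2 + a ^ 2 := by
  have hP1 : 0 < P - 1 := by linarith
  rcases eq_or_ne a 0 with rfl | ha
  · have : 0 < b ^ 2 := by simpa using h
    simpa using mul_pos hP1 this
  · positivity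

/-- The modulus of a Wolff function is bounded above and below: `log (w² + w'²)` plus a bounded
function is a first integral. -/
theorem IsWolffFunction.exists_modulus_bounds (hP : 1 < P) (hw : IsWolffFunction P w) :
    ∃ m M : ℝ, 0 < m ∧ ∀ s, m ≤ wolffModulus w s ∧ wolffModulus w s ≤ M := by
  have hP1 : 0 < P - 1 := by linarith
  set κ : ℝ := (2 - P) / (P - 1) with hκ
  let Q : ℝ → ℝ := fun s => Real.log (wolffModulus w s) + κ * (deriv w s ^ 2 / wolffModulus w s)
  have hQ : ∀ s, HasDerivAt Q 0 s := fun s => by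
    have hE := hw.modulus_pos hP s
    have h1 := (hw.hasDerivAt_modulus s).log hE.ne'
    have h2 := (((hw.hasDerivAt_deriv s).pow 2).div (hw.hasDerivAt_modulus s) hE.ne').const_mul κ
    refine (h1.add h2).congr_deriv ?_
    have hN := (wolff_denom_pos hP (show 0 < w s ^ 2 + deriv w s ^ 2 from hE)).ne'
    have hE' : w s ^ 2 + deriv w s ^ 2 ≠ 0 := hE.ne'
    simp only [wolffV, wolffModulus, hκ, Pi.pow_apply]
    generalize deriv w s = b at *
    generalize w s = a at *
    push_cast
    have hN' : b ^ 2 * (P - 1) + a ^ 2 ≠ 0 := by rwa [mul_comm]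
    field_simp
    ring
  have hconst : ∀ s, Q s = Q 0 := fun s =>
    is_const_of_deriv_eq_zero (fun x => (hQ x).differentiableAt) (fun x => (hQ x).deriv) s 0
  have hbd : ∀ s, |κ * (deriv w s ^ 2 / wolffModulus w s)| ≤ |κ| := fun s => by
    have hE := hw.modulus_pos hP s
    rw [abs_mul]
    refine mul_le_of_le_one_right (abs_nonneg _) ?_
    rw [abs_of_nonneg (by positivity), div_le_one hE, wolffModulus]
    linarith [sq_nonneg (w s)]
  refine ⟨Real.exp (Q 0 - |κ|), Real.exp (Q 0 + |κ|), Real.exp_pos _, fun s => ?_⟩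
  have hE := hw.modulus_pos hP s
  have h := hconst s
  have hb := abs_le.1 (hbd s)
  rw [← Real.le_log_iff_exp_le hE, ← Real.log_le_iff_le_exp hE]
  simp only [Q] at h ⊢
  constructor <;> linarith [hb.1, hb.2]

/-- The equation for the flux of a Wolff function. -/
theorem IsWolffFunction.hasDerivAt_flux (hP : 1 < P) (hw : IsWolffFunction P w) (s : ℝ) :
    HasDerivAt (fun s => wolffModulus w s ^ ((P - 2) / 2) * deriv w s)
      (-(P - 1) * (wolffModulus w s ^ ((P - 2) / 2) * w s)) s := by
  have hE := hw.modulus_pos hP s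
  have h1 := (hw.hasDerivAt_modulus s).rpow_const (p := (P - 2) / 2) (Or.inl hE.ne')
  refine (h1.mul (hw.hasDerivAt_deriv s)).congr_deriv ?_
  have hN := (wolff_denom_pos hP (show 0 < w s ^ 2 + deriv w s ^ 2 from hE)).ne'
  have hE' : w s ^ 2 + deriv w s ^ 2 ≠ 0 := hE.ne'
  rw [Real.rpow_sub_one hE.ne']
  generalize wolffModulus w s ^ ((P - 2) / 2) = r
  simp only [wolffV, wolffModulus]
  generalize deriv w s = b at *
  generalize w s = a at *
  have hN' : b ^ 2 * (P - 1) + a ^ 2 ≠ 0 := by rwa [mul_comm]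
  field_simp
  ring

end WolffFunction

/-! ### Wolff solutions are `p`-harmonic -/

section WolffSolution

variable {d : ℕ} {P : ℝ} {w : ℝ → ℝ} {t τ : ℝ} {ρ ρ' : Space d}

theorem hasFDerivAt_exp_mul {F : ℝ → ℝ} {F' : ℝ} (c t τ : ℝ) (ρ ρ' : Space d) {x : Space d}
    (hF : HasDerivAt F F' (τ * inner ℝ ρ' x)) :
    HasFDerivAt (fun x : Space d => Real.exp (c * (inner ℝ ρ x - t)) * F (τ * inner ℝ ρ' x))
      (Real.exp (c * (inner ℝ ρ x - t)) • ((c * F (τ * inner ℝ ρ' x)) • innerSL ℝ ρ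
        + (τ * F') • innerSL ℝ ρ')) x := by
  have h1 : HasFDerivAt (fun x : Space d => c * (inner ℝ ρ x - t)) (c • innerSL ℝ ρ) x :=
    ((innerSL ℝ ρ).hasFDerivAt.sub_const t).const_mul c
  have h2 : HasFDerivAt (fun x : Space d => τ * inner ℝ ρ' x) (τ • innerSL ℝ ρ') x :=
    (innerSL ℝ ρ').hasFDerivAt.const_mul τ
  refine (h1.exp.mul (hF.comp_hasFDerivAt x h2)).congr_fderiv ?_
  ext y
  simp
  ring

theorem contDiff_exp_mul {n : WithTop ℕ∞} {F : ℝ → ℝ} (hF : ContDiff ℝ n F) (c t τ : ℝ)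
    (ρ ρ' : Space d) :
    ContDiff ℝ n fun x : Space d =>
      Real.exp (c * (inner ℝ ρ x - t)) * F (τ * inner ℝ ρ' x) := by
  have h : ∀ v : Space d, ContDiff ℝ n fun x : Space d => inner ℝ v x := fun v =>
    contDiff_const.inner ℝ contDiff_id
  exact (Real.contDiff_exp.comp (contDiff_const.mul ((h ρ).sub contDiff_const))).mul
    (hF.comp (contDiff_const.mul (h ρ')))

theorem gradient_wolffSolution (hw : IsWolffFunction P w) (x : Space d) :
    gradient (wolffSolution w t ρ ρ' τ) x = (τ * Real.exp (τ * (inner ℝ ρ x - t))) •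
      (w (τ * inner ℝ ρ' x) • ρ + deriv w (τ * inner ℝ ρ' x) • ρ') := by
  refine HasGradientAt.gradient ?_
  rw [hasGradientAt_iff_hasFDerivAt]
  refine (hasFDerivAt_exp_mul τ t τ ρ ρ' (hw.hasDerivAt _)).congr_fderiv ?_
  ext y
  simp
  ring

theorem norm_gradient_wolffSolution (hw : IsWolffFunction P w) (hτ : 0 < τ) (hρ : ‖ρ‖ = 1)
    (hρ' : ‖ρ'‖ = 1) (hort : inner ℝ ρ ρ' = 0) (x : Space d) :
    ‖gradient (wolffSolution w t ρ ρ' τ) x‖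
      = τ * Real.exp (τ * (inner ℝ ρ x - t)) * wolffModulus w (τ * inner ℝ ρ' x) ^ (1 / 2 : ℝ) := by
  rw [gradient_wolffSolution hw, norm_smul, Real.norm_of_nonneg (by positivity)]
  congr 1
  rw [← Real.sqrt_eq_rpow, eq_comm, wolffModulus, Real.sqrt_eq_iff_eq_sq
    (add_nonneg (sq_nonneg _) (sq_nonneg _)) (norm_nonneg _), norm_add_sq_real,
    norm_smul, norm_smul, hρ, hρ', real_inner_smul_left, real_inner_smul_right, hort]
  simp

theorem norm_gradient_wolffSolution_rpow (hw : IsWolffFunction P w) (hτ : 0 < τ) (hρ : ‖ρ‖ = 1)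
    (hρ' : ‖ρ'‖ = 1) (hort : inner ℝ ρ ρ' = 0) (x : Space d) (q : ℝ) :
    ‖gradient (wolffSolution w t ρ ρ' τ) x‖ ^ q = τ ^ q *
      Real.exp (q * τ * (inner ℝ ρ x - t)) * wolffModulus w (τ * inner ℝ ρ' x) ^ (q / 2) := by
  have hE : 0 ≤ wolffModulus w (τ * inner ℝ ρ' x) := add_nonneg (sq_nonneg _) (sq_nonneg _)
  rw [norm_gradient_wolffSolution hw hτ hρ hρ' hort, Real.mul_rpow (by positivity) (by positivity),
    Real.mul_rpow hτ.le (by positivity), ← Real.exp_mul, ← Real.rpow_mul hE]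
  ring_nf

/-- Wolff solutions are weakly `p`-harmonic. -/
theorem integral_wolff_flux_eq_zero {Ω : Set (Space d)} (hP : 1 < P) (hw : IsWolffFunction P w)
    (hτ : 0 < τ) (hρ : ‖ρ‖ = 1) (hρ' : ‖ρ'‖ = 1) (hort : inner ℝ ρ ρ' = 0)
    {φ : Space d → ℝ} (hφ : IsTestFunction Ω φ) :
    ∫ x in Ω, ‖gradient (wolffSolution w t ρ ρ' τ) x‖ ^ (P - 2) *
      inner ℝ (gradient (wolffSolution w t ρ ρ' τ) x) (gradient φ x) = 0 := by
  let A : ℝ → ℝ := fun s => wolffModulus w s ^ ((P - 2) / 2) * w s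
  let B : ℝ → ℝ := fun s => wolffModulus w s ^ ((P - 2) / 2) * deriv w s
  have hr : ContDiff ℝ 1 fun s => wolffModulus w s ^ ((P - 2) / 2) :=
    (hw.contDiff_modulus.of_le (by simp)).rpow_const_of_ne fun s => (hw.modulus_pos hP s).ne'
  have hA : ContDiff ℝ 1 A := hr.mul (hw.smooth.of_le (by simp))
  have hB : ContDiff ℝ 1 B := hr.mul (hw.contDiff_deriv.of_le (by simp))
  let h₁ : Space d → ℝ := fun x =>
    Real.exp ((P - 1) * τ * (inner ℝ ρ x - t)) * A (τ * inner ℝ ρ' x)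
  let h₂ : Space d → ℝ := fun x =>
    Real.exp ((P - 1) * τ * (inner ℝ ρ x - t)) * B (τ * inner ℝ ρ' x)
  have hh₁ : ContDiff ℝ 1 h₁ := contDiff_exp_mul hA _ _ _ _ _
  have hh₂ : ContDiff ℝ 1 h₂ := contDiff_exp_mul hB _ _ _ _ _
  have hρρ : inner ℝ ρ ρ = (1 : ℝ) := by rw [real_inner_self_eq_norm_sq, hρ, one_pow]
  have hρρ' : inner ℝ ρ' ρ' = (1 : ℝ) := by rw [real_inner_self_eq_norm_sq, hρ', one_pow]
  have hort' : inner ℝ ρ' ρ = (0 : ℝ) := by rw [real_inner_comm, hort]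
  -- Up to `τ^(P-1)`, the flux is `h₁ ρ + h₂ ρ'`. It is divergence free because `B' = -(P - 1) A`,
  -- which is the Wolff equation in flux form.
  have hdiv : ∀ x, fderiv ℝ h₁ x ρ = - fderiv ℝ h₂ x ρ' := fun x => by
    have hA' := (hA.differentiable (by simp) (τ * inner ℝ ρ' x)).hasDerivAt
    rw [(hasFDerivAt_exp_mul ((P - 1) * τ) t τ ρ ρ' hA').fderiv,
      (hasFDerivAt_exp_mul ((P - 1) * τ) t τ ρ ρ'
        (hw.hasDerivAt_flux hP (τ * inner ℝ ρ' x))).fderiv]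
    simp only [smul_apply, add_apply,
      innerSL_apply_apply, hρρ, hρρ', hort, hort', smul_eq_mul, A]
    ring
  have hpt : ∀ x, ‖gradient (wolffSolution w t ρ ρ' τ) x‖ ^ (P - 2) *
      inner ℝ (gradient (wolffSolution w t ρ ρ' τ) x) (gradient φ x)
      = τ ^ (P - 1) * (fderiv ℝ φ x ρ * h₁ x + fderiv ℝ φ x ρ' * h₂ x) := fun x => by
    have e1 : τ ^ (P - 1) = τ ^ (P - 2) * τ := (rpow_sub_two_mul_self hP hτ.le).symm
    have e2 : Real.exp ((P - 1) * τ * (inner ℝ ρ x - t))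
        = Real.exp ((P - 2) * τ * (inner ℝ ρ x - t)) * Real.exp (τ * (inner ℝ ρ x - t)) := by
      rw [← Real.exp_add]
      ring_nf
    have e3 : ∀ v : Space d, inner ℝ v (gradient φ x) = fderiv ℝ φ x v := fun v => by
      rw [real_inner_comm, inner_gradient_left]
    rw [norm_gradient_wolffSolution_rpow hw hτ hρ hρ' hort, gradient_wolffSolution hw,
      real_inner_smul_left, inner_add_left, real_inner_smul_left, real_inner_smul_left, e3, e3]
    simp only [h₁, h₂, A, B, e1, e2]
    ring
  simp only [hpt]
  have hint : ∀ v : Space d, ∀ h : Space d → ℝ, ContDiff ℝ 1 h →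
      Integrable (fun x => fderiv ℝ φ x v * h x) (volume.restrict Ω) := fun v h hh =>
    (((hφ.continuous_fderiv_apply v).mul hh.continuous).integrable_of_hasCompactSupport
      (hφ.compact.fderiv_apply ℝ v).mul_right).integrableOn
  rw [integral_const_mul, integral_add (hint ρ h₁ hh₁) (hint ρ' h₂ hh₂),
    hφ.setIntegral_fderiv_mul hh₁, hφ.setIntegral_fderiv_mul hh₂]
  simp only [hdiv, mul_neg, integral_neg]
  ring

/-- The boundary values of a Wolff solution are those of a minimizer of the background energy,
whose gradient is the classical one. -/
theorem exists_isMinimizer_traceOf_wolffSolution {p : ℝ≥0∞} [Fact (1 ≤ p)] {Ω : Set (Space d)}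
    (hp₁ : 1 < p) (hp : p ≠ ⊤) (hΩo : IsOpen Ω) (hΩ : Bornology.IsBounded Ω)
    (hw : IsWolffFunction p.toReal w) (hτ : 0 < τ) (hρ : ‖ρ‖ = 1) (hρ' : ‖ρ'‖ = 1)
    (hort : inner ℝ ρ ρ' = 0) :
    ∃ u : sobolev p Ω, traceOf p Ω (wolffSolution w t ρ ρ' τ) = trace u ∧ IsMinimizer 1 u ∧
      grad u =ᵐ[volume.restrict Ω] gradient (wolffSolution w t ρ ρ' τ) := by
  have hP := one_lt_toReal hp₁ hp
  have hW : ContDiff ℝ 1 (wolffSolution w t ρ ρ' τ) :=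
    contDiff_exp_mul (hw.smooth.of_le (by simp)) _ _ _ _ _
  obtain ⟨u, hu, hg⟩ := exists_traceOf_eq (p := p) hΩo hΩ hW
  refine ⟨u, hu, isMinimizer_of_fluxPairing_eq_zero hp₁ hp isElliptic_one fun v hv => ?_, hg⟩
  obtain ⟨L, hL⟩ := exists_clm_eq_lpFlux hp₁ hp isElliptic_one (grad u)
  have hcl : IsClosed {v : sobolev p Ω | fluxPairing 1 u v = 0} := by
    have : Continuous fun v : sobolev p Ω => fluxPairing 1 u v := by
      simp only [fluxPairing_eq, ← hL]
      exact L.continuous.comp (gradL (p := p) (Ω := Ω)).continuous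
    exact isClosed_eq this continuous_const
  refine sobolevZero_induction hcl (fun v φ hφ hv => ?_) hv
  have hgv := grad_ae_eq_gradient hΩo hΩ (hφ.smooth.of_le (by simp)) hv
  rw [Set.mem_ofPred_eq, ← integral_wolff_flux_eq_zero (t := t) hP hw hτ hρ hρ' hort hφ]
  refine integral_congr_ae ?_
  filter_upwards [hg, hgv] with x h1 h2
  rw [h1, h2, Pi.one_apply, one_mul]

end WolffSolution

/-! ### Monotonicity bounds for the Dirichlet-to-Neumann gap -/

section Monotonicity

variable {d : ℕ} {p : ℝ≥0∞} [Fact (1 ≤ p)] {Ω : Set (Space d)} {σ : Space d → ℝ}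

/-- The quadratic-form difference `⟨(Λ_σ - Λ_1) f, f⟩`. -/
def dnGap (σ : Space d → ℝ) (f : BoundaryValues p Ω) : ℝ := (dnMap p Ω σ f - dnMap p Ω 1 f) f

theorem exists_dnGap_eq (hd : 1 ≤ d) (hp₁ : 1 < p) (hp : p ≠ ⊤) (hΩo : IsOpen Ω)
    (hΩ : Bornology.IsBounded Ω) (hσ : IsElliptic σ) {u : sobolev p Ω} (hu : IsMinimizer 1 u) :
    ∃ v : sobolev p Ω, trace v = trace u ∧ IsMinimizer σ v ∧
      dnGap σ (trace u) = energy σ v - energy 1 u := by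
  have h1 := isDNMap_dnMap (p := p) hd hp₁ hp hΩo hΩ hσ
  have h2 := isDNMap_dnMap (p := p) hd hp₁ hp hΩo hΩ isElliptic_one
  obtain ⟨v, hv, hmin⟩ := h1.exists_minimizer (trace u)
  refine ⟨v, hv, hmin, ?_⟩
  rw [dnGap, sub_apply, h2.pairing u u hu, ← hv, h1.pairing v v hmin,
    fluxPairing_eq, fluxPairing_eq, lpFlux_self hp₁ hp, lpFlux_self hp₁ hp, energy_eq, energy_eq]

theorem integrable_grad_rpow (hp₁ : 1 < p) (hp : p ≠ ⊤) (u : sobolev p Ω) :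
    Integrable (fun x => ‖grad u x‖ ^ p.toReal) (volume.restrict Ω) :=
  integrable_norm_rpow' hp₁ hp (Lp.memLp (grad u))

theorem energy_one (u : sobolev p Ω) : energy 1 u = ∫ x in Ω, ‖grad u x‖ ^ p.toReal := by
  simp [energy]

/-- The background minimizer is a competitor in the `σ`-problem with the same boundary values. -/
theorem dnGap_le (hd : 1 ≤ d) (hp₁ : 1 < p) (hp : p ≠ ⊤) (hΩo : IsOpen Ω)
    (hΩ : Bornology.IsBounded Ω) (hσ : IsElliptic σ) {u : sobolev p Ω} (hu : IsMinimizer 1 u) :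
    dnGap σ (trace u) ≤ ∫ x in Ω, (σ x - 1) * ‖grad u x‖ ^ p.toReal := by
  obtain ⟨v, hv, hmin, hgap⟩ := exists_dnGap_eq hd hp₁ hp hΩo hΩ hσ hu
  have hi := integrable_grad_rpow hp₁ hp u
  simp only [sub_mul, one_mul]
  rw [hgap, energy_one, integral_sub (hσ.integrable_mul hi) hi]
  exact sub_le_sub_right (hmin u hv.symm) _

theorem IsElliptic.rpow (hσ : IsElliptic σ) (q : ℝ) : IsElliptic fun x => σ x ^ q := by
  obtain ⟨m, hm, hmσ⟩ := hσ.lower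
  obtain ⟨M, hM⟩ := hσ.upper
  -- The maximum with `m` secures a positive base without needing a point of the domain.
  refine ⟨hσ.measurable.pow_const q, ⟨min (m ^ q) (max M m ^ q), ?_, fun x => ?_⟩,
    ⟨max (m ^ q) (M ^ q), fun x => ?_⟩⟩
  · have : 0 < max M m := lt_max_of_lt_right hm
    positivity
  · rcases le_total 0 q with hq | hq
    · exact (min_le_left _ _).trans (Real.rpow_le_rpow hm.le (hmσ x) hq)
    · exact (min_le_right _ _).trans
        (Real.rpow_le_rpow_of_nonpos (hσ.pos x) ((hM x).trans (le_max_left _ _)) hq)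
  · rcases le_total 0 q with hq | hq
    · exact (Real.rpow_le_rpow (hσ.nonneg x) (hM x) hq).trans (le_max_right _ _)
    · exact (Real.rpow_le_rpow_of_nonpos hm (hmσ x) hq).trans (le_max_left _ _)

/-- Let `v` minimize the `σ`-energy. As `v - u` lies in `W^{1,p}_0`, the background flux of `u`
pairs with `v` to the energy of `u`; Young's inequality with weight `σ x` bounds this pairing by the
`σ`-energy of `v` and a weighted energy of `u`. -/
theorem le_dnGap (hd : 1 ≤ d) (hp₁ : 1 < p) (hp : p ≠ ⊤) (hΩo : IsOpen Ω)
    (hΩ : Bornology.IsBounded Ω) (hσ : IsElliptic σ) {u : sobolev p Ω} (hu : IsMinimizer 1 u) :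
    ∫ x in Ω, (p.toReal - 1) * (1 - σ x ^ (-1 / (p.toReal - 1))) * ‖grad u x‖ ^ p.toReal
      ≤ dnGap σ (trace u) := by
  have hP := one_lt_toReal hp₁ hp
  obtain ⟨v, hv, -, hgap⟩ := exists_dnGap_eq hd hp₁ hp hΩo hΩ hσ hu
  have hi := integrable_grad_rpow hp₁ hp u
  have hs := (hσ.rpow (-1 / (p.toReal - 1))).integrable_mul hi
  have hEL : fluxPairing 1 u v = energy 1 u := by
    have h1 := hu.fluxPairing_eq_zero hp₁ hp isElliptic_one (trace_eq_iff.1 hv)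
    have h2 := fluxPairing_add_right hp₁ hp isElliptic_one u u (v - u)
    rw [add_sub_cancel, h1, add_zero] at h2
    rw [h2, fluxPairing_eq, lpFlux_self hp₁ hp, energy_eq]
  have hflux := integrable_flux hp₁ hp isElliptic_one (Lp.memLp (grad u)) (Lp.memLp (grad v))
  have hv' := integrable_lpEnergy hp₁ hp hσ (grad v)
  have key : p.toReal * fluxPairing 1 u v ≤ energy σ v + (p.toReal - 1) *
      ∫ x in Ω, σ x ^ (-1 / (p.toReal - 1)) * ‖grad u x‖ ^ p.toReal := by
    rw [fluxPairing, energy, ← integral_const_mul, ← integral_const_mul,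
      ← integral_add hv' (hs.const_mul _)]
    refine integral_mono (hflux.const_mul _) (hv'.add (hs.const_mul _)) fun x => ?_
    have := flux_mul_le hP (hσ.pos x) (grad u x) (grad v x)
    simp only [Pi.one_apply, one_mul, ← mul_assoc] at this ⊢
    exact this
  have e : ∫ x in Ω, (p.toReal - 1) * (1 - σ x ^ (-1 / (p.toReal - 1))) * ‖grad u x‖ ^ p.toReal
      = (p.toReal - 1) * energy 1 u - (p.toReal - 1) *
        ∫ x in Ω, σ x ^ (-1 / (p.toReal - 1)) * ‖grad u x‖ ^ p.toReal := by
    rw [energy_one, ← mul_sub, ← integral_sub hi hs, ← integral_const_mul]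
    refine integral_congr_ae (ae_of_all _ fun x => ?_)
    simp only
    ring
  rw [hEL] at key
  rw [e, hgap]
  linarith

end Monotonicity

/-! ### From the inclusion to the indicator function -/

section Inclusion

variable {d : ℕ} {p : ℝ≥0∞} [Fact (1 ≤ p)] {Ω D : Set (Space d)} {σD : Space d → ℝ}

theorem inclusionConductivity_of_mem {x : Space d} (hx : x ∈ D) :
    inclusionConductivity D σD x = 1 + σD x := by simp [inclusionConductivity, hx]

theorem inclusionConductivity_of_notMem {x : Space d} (hx : x ∉ D) :
    inclusionConductivity D σD x = 1 := by simp [inclusionConductivity, hx]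

theorem isElliptic_inclusionConductivity
    (hmeas : Measurable (inclusionConductivity D σD)) {a b : ℝ} (ha : 0 < 1 + a)
    (h : ∀ x ∈ D, a ≤ σD x ∧ σD x ≤ b) : IsElliptic (inclusionConductivity D σD) := by
  refine ⟨hmeas, ⟨min 1 (1 + a), by positivity, fun x => ?_⟩, ⟨max 1 (1 + b), fun x => ?_⟩⟩ <;>
  by_cases hx : x ∈ D
  · rw [inclusionConductivity_of_mem hx]
    exact (min_le_right _ _).trans (by linarith [(h x hx).1])
  · rw [inclusionConductivity_of_notMem hx]
    exact min_le_left _ _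
  · rw [inclusionConductivity_of_mem hx]
    exact le_max_of_le_right (by linarith [(h x hx).2])
  · rw [inclusionConductivity_of_notMem hx]
    exact le_max_left _ _

theorem setIntegral_mul_le_of_le_on (hDm : MeasurableSet D) (hDΩ : D ⊆ Ω) {a g : Space d → ℝ}
    {k : ℝ} (hag : Integrable (fun x => a x * g x) (volume.restrict Ω))
    (hg : Integrable g (volume.restrict Ω)) (hg0 : ∀ x, 0 ≤ g x)
    (hD : ∀ x ∈ D, a x ≤ k) (hDc : ∀ x ∉ D, a x = 0) :
    ∫ x in Ω, a x * g x ≤ k * ∫ x in D, g x := by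
  have h : ∫ x in D, g x = ∫ x in Ω, D.indicator g x := by
    rw [setIntegral_indicator hDm, Set.inter_eq_self_of_subset_right hDΩ]
  rw [h, ← integral_const_mul]
  refine integral_mono hag ((hg.indicator hDm).const_mul k) fun x => ?_
  by_cases hx : x ∈ D
  · simpa [hx] using mul_le_mul_of_nonneg_right (hD x hx) (hg0 x)
  · simp [hx, hDc x hx]

theorem le_setIntegral_mul_of_le_on (hDm : MeasurableSet D) (hDΩ : D ⊆ Ω) {a g : Space d → ℝ}
    {k : ℝ} (hag : Integrable (fun x => a x * g x) (volume.restrict Ω))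
    (hg : Integrable g (volume.restrict Ω)) (hg0 : ∀ x, 0 ≤ g x)
    (hD : ∀ x ∈ D, k ≤ a x) (hDc : ∀ x ∉ D, a x = 0) :
    k * ∫ x in D, g x ≤ ∫ x in Ω, a x * g x := by
  have h := setIntegral_mul_le_of_le_on (a := fun x => -a x) (k := -k) hDm hDΩ
    (by simpa using hag.neg) hg hg0 (fun x hx => neg_le_neg (hD x hx))
    (fun x hx => by simp [hDc x hx])
  simp only [neg_mul, integral_neg] at h
  linarith

/-- Two-sided bounds of the gap by the background energy in the inclusion, when the bounds
`a ≤ σ_D ≤ b` are given. -/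
theorem dnGap_bounds (hd : 1 ≤ d) (hp₁ : 1 < p) (hp : p ≠ ⊤) (hΩo : IsOpen Ω)
    (hΩ : Bornology.IsBounded Ω) (hDo : IsOpen D) (hDΩ : D ⊆ Ω)
    (hmeas : Measurable (inclusionConductivity D σD)) {a b : ℝ} (ha : 0 < 1 + a)
    (h : ∀ x ∈ D, a ≤ σD x ∧ σD x ≤ b) {u : sobolev p Ω} (hu : IsMinimizer 1 u) :
    (p.toReal - 1) * (1 - (1 + a) ^ (-1 / (p.toReal - 1))) * (∫ x in D, ‖grad u x‖ ^ p.toReal)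
        ≤ dnGap (inclusionConductivity D σD) (trace u) ∧
      dnGap (inclusionConductivity D σD) (trace u) ≤ b * ∫ x in D, ‖grad u x‖ ^ p.toReal := by
  have hP := one_lt_toReal hp₁ hp
  have hP1 : 0 < p.toReal - 1 := by linarith
  have hσ := isElliptic_inclusionConductivity hmeas ha h
  have hi := integrable_grad_rpow hp₁ hp u
  constructor
  · refine le_trans ?_ (le_dnGap hd hp₁ hp hΩo hΩ hσ hu)
    refine le_setIntegral_mul_of_le_on hDo.measurableSet hDΩ ?_ hi (fun x => by positivity)
      (fun x hx => ?_) (fun x hx => ?_)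
    · have h1 := ((hi.sub ((hσ.rpow (-1 / (p.toReal - 1))).integrable_mul hi)).const_mul
        (p.toReal - 1))
      refine h1.congr (ae_of_all _ fun x => ?_)
      simp only [Pi.sub_apply]
      ring
    · rw [inclusionConductivity_of_mem hx]
      have : (1 + σD x) ^ (-1 / (p.toReal - 1)) ≤ (1 + a) ^ (-1 / (p.toReal - 1)) :=
        Real.rpow_le_rpow_of_nonpos ha (by linarith [(h x hx).1])
          (div_nonpos_of_nonpos_of_nonneg (by norm_num) hP1.le)
      gcongr
    · rw [inclusionConductivity_of_notMem hx, Real.one_rpow, sub_self, mul_zero]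
  · refine (dnGap_le hd hp₁ hp hΩo hΩ hσ hu).trans ?_
    refine setIntegral_mul_le_of_le_on hDo.measurableSet hDΩ ?_ hi (fun x => by positivity)
      (fun x hx => ?_) (fun x hx => ?_)
    · refine ((hσ.integrable_mul hi).sub hi).congr (ae_of_all _ fun x => ?_)
      simp only [Pi.sub_apply]
      ring
    · rw [inclusionConductivity_of_mem hx]
      linarith [(h x hx).2]
    · rw [inclusionConductivity_of_notMem hx, sub_self]

/-- The weight `∫_D exp (P τ (ρ · x - t))` that governs the indicator function. -/
def expWeight (D : Set (Space d)) (P t : ℝ) (ρ : Space d) (τ : ℝ) : ℝ :=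
  ∫ x in D, Real.exp (P * τ * (inner ℝ ρ x - t))

theorem expWeight_nonneg (D : Set (Space d)) (P t : ℝ) (ρ : Space d) (τ : ℝ) :
    0 ≤ expWeight D P t ρ τ :=
  integral_nonneg fun _ => (Real.exp_pos _).le

theorem integrableOn_exp (hDb : Bornology.IsBounded D) (hDo : IsOpen D) (P t : ℝ) (ρ : Space d)
    (τ : ℝ) : IntegrableOn (fun x => Real.exp (P * τ * (inner ℝ ρ x - t))) D :=
  memLp_one_iff_integrable.1 (memLp_of_continuous hDb hDo.measurableSet (by fun_prop))

theorem setIntegral_norm_gradient_wolffSolution_bounds (hDb : Bornology.IsBounded D)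
    (hDo : IsOpen D) {P : ℝ} (hP : 1 < P) {w : ℝ → ℝ} (hw : IsWolffFunction P w) {m M : ℝ}
    (hm : 0 < m) (hmM : ∀ s, m ≤ wolffModulus w s ∧ wolffModulus w s ≤ M)
    {t τ : ℝ} {ρ ρ' : Space d} (hτ : 0 < τ) (hρ : ‖ρ‖ = 1) (hρ' : ‖ρ'‖ = 1)
    (hort : inner ℝ ρ ρ' = 0) :
    τ ^ P * m ^ (P / 2) * expWeight D P t ρ τ
        ≤ ∫ x in D, ‖gradient (wolffSolution w t ρ ρ' τ) x‖ ^ P ∧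
      ∫ x in D, ‖gradient (wolffSolution w t ρ ρ' τ) x‖ ^ P
        ≤ τ ^ P * M ^ (P / 2) * expWeight D P t ρ τ := by
  have hi := integrableOn_exp hDb hDo P t ρ τ
  have hW : ContDiff ℝ 1 (wolffSolution w t ρ ρ' τ) :=
    contDiff_exp_mul (hw.smooth.of_le (by simp)) _ _ _ _ _
  have hg : IntegrableOn (fun x => ‖gradient (wolffSolution w t ρ ρ' τ) x‖ ^ P) D :=
    memLp_one_iff_integrable.1 (memLp_of_continuous hDb hDo.measurableSet
      ((continuous_gradient hW).norm.rpow_const fun _ => Or.inr (by linarith)))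
  rw [expWeight, ← integral_const_mul, ← integral_const_mul]
  refine ⟨integral_mono (hi.const_mul _) hg fun x => ?_,
    integral_mono hg (hi.const_mul _) fun x => ?_⟩ <;>
  simp only [norm_gradient_wolffSolution_rpow hw hτ hρ hρ' hort]
  · calc τ ^ P * m ^ (P / 2) * Real.exp (P * τ * (inner ℝ ρ x - t))
        = τ ^ P * Real.exp (P * τ * (inner ℝ ρ x - t)) * m ^ (P / 2) := by ring
      _ ≤ _ := by
        gcongr
        exact (hmM _).1
  · calc τ ^ P * Real.exp (P * τ * (inner ℝ ρ x - t)) *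
          wolffModulus w (τ * inner ℝ ρ' x) ^ (P / 2)
        ≤ τ ^ P * Real.exp (P * τ * (inner ℝ ρ x - t)) * M ^ (P / 2) := by
          gcongr
          · exact hm.le.trans (hmM _).1
          · exact (hmM _).2
      _ = _ := by ring

/-- Two-sided bounds of the indicator function. -/
theorem exists_indicatorFunction_bounds (hp₁ : 1 < p) (hp : p ≠ ⊤)
    (hΩo : IsOpen Ω) (hΩ : Bornology.IsBounded Ω) (hDo : IsOpen D) (hDΩ : D ⊆ Ω) {s : ℝ}
    (hgap : ∃ k K : ℝ, 0 < k ∧ ∀ u : sobolev p Ω, IsMinimizer 1 u →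
      k * (∫ x in D, ‖grad u x‖ ^ p.toReal)
          ≤ s * dnGap (inclusionConductivity D σD) (trace u) ∧
        s * dnGap (inclusionConductivity D σD) (trace u)
          ≤ K * ∫ x in D, ‖grad u x‖ ^ p.toReal)
    {w : ℝ → ℝ} (hw : IsWolffFunction p.toReal w) :
    ∃ k K : ℝ, 0 < k ∧ ∀ (t τ : ℝ) (ρ ρ' : Space d), 0 < τ → ‖ρ‖ = 1 → ‖ρ'‖ = 1 →
      inner ℝ ρ ρ' = 0 →
      k * (τ ^ (d : ℝ) * expWeight D p.toReal t ρ τ)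
          ≤ s * indicatorFunction p Ω w (dnMap p Ω (inclusionConductivity D σD)) t ρ ρ' τ ∧
        s * indicatorFunction p Ω w (dnMap p Ω (inclusionConductivity D σD)) t ρ ρ' τ
          ≤ K * (τ ^ (d : ℝ) * expWeight D p.toReal t ρ τ) := by
  have hP := one_lt_toReal hp₁ hp
  obtain ⟨k, K, hk, hkK⟩ := hgap
  obtain ⟨m, M, hm, hmM⟩ := hw.exists_modulus_bounds hP
  -- The sign of `K` is not given, and the upper bound on the Wolff energy may only be multiplied by
  -- a nonnegative constant; hence `|K|`.
  refine ⟨k * m ^ (p.toReal / 2), |K| * M ^ (p.toReal / 2), by positivity,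
    fun t τ ρ ρ' hτ hρ hρ' hort => ?_⟩
  obtain ⟨u, htr, hmin, hgrad⟩ := exists_isMinimizer_traceOf_wolffSolution (t := t) hp₁ hp hΩo hΩ
    hw hτ hρ hρ' hort
  have hI : s * indicatorFunction p Ω w (dnMap p Ω (inclusionConductivity D σD)) t ρ ρ' τ
      = τ ^ ((d : ℝ) - p.toReal) * (s * dnGap (inclusionConductivity D σD) (trace u)) := by
    rw [indicatorFunction, htr, dnGap]
    ring
  have hJ : ∫ x in D, ‖grad u x‖ ^ p.toReal
      = ∫ x in D, ‖gradient (wolffSolution w t ρ ρ' τ) x‖ ^ p.toReal := by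
    refine integral_congr_ae ?_
    filter_upwards [ae_restrict_of_ae_restrict_of_subset hDΩ hgrad] with x hx
    rw [hx]
  obtain ⟨h1, h2⟩ := hkK u hmin
  obtain ⟨h3, h4⟩ := setIntegral_norm_gradient_wolffSolution_bounds (t := t) (hΩ.subset hDΩ) hDo hP
    hw hm hmM hτ hρ hρ' hort
  rw [hJ] at h1 h2
  have hpow : τ ^ (d : ℝ) = τ ^ ((d : ℝ) - p.toReal) * τ ^ p.toReal := by
    rw [← Real.rpow_add hτ]
    ring_nf
  have hJ0 : 0 ≤ ∫ x in D, ‖gradient (wolffSolution w t ρ ρ' τ) x‖ ^ p.toReal :=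
    integral_nonneg fun x => by positivity
  rw [hI, hpow]
  have hτd : 0 ≤ τ ^ ((d : ℝ) - p.toReal) := by positivity
  generalize τ ^ ((d : ℝ) - p.toReal) = r at hτd ⊢
  generalize s * dnGap (inclusionConductivity D σD) (trace u) = V at h1 h2 ⊢
  generalize ∫ x in D, ‖gradient (wolffSolution w t ρ ρ' τ) x‖ ^ p.toReal = J
    at h1 h2 h3 h4 hJ0
  generalize expWeight D p.toReal t ρ τ = A at h3 h4 ⊢
  constructor
  · calc _ = r * (k * (τ ^ p.toReal * m ^ (p.toReal / 2) * A)) := by ring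
      _ ≤ r * V :=
        mul_le_mul_of_nonneg_left ((mul_le_mul_of_nonneg_left h3 hk.le).trans h1) hτd
  · calc r * V ≤ r * (|K| * (τ ^ p.toReal * M ^ (p.toReal / 2) * A)) :=
        mul_le_mul_of_nonneg_left ((h2.trans (mul_le_mul_of_nonneg_right (le_abs_self K)
          hJ0)).trans (mul_le_mul_of_nonneg_left h4 (abs_nonneg K))) hτd
      _ = _ := by ring

/-! ### Asymptotics of the exponential weight -/

theorem expWeight_pos (hDb : Bornology.IsBounded D) (hDo : IsOpen D) (hne : D.Nonempty)
    (P t : ℝ) (ρ : Space d) (τ : ℝ) : 0 < expWeight D P t ρ τ := by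
  rw [expWeight, setIntegral_pos_iff_support_of_nonneg_ae
    (ae_of_all _ fun x => (Real.exp_pos _).le) (integrableOn_exp hDb hDo P t ρ τ)]
  have : Function.support (fun x => Real.exp (P * τ * (inner ℝ ρ x - t))) = Set.univ := by
    ext x
    simp [(Real.exp_pos _).ne']
  rw [this, Set.univ_inter]
  exact hDo.measure_pos volume hne

/-- The factor `e^(-Pδτ)` beats `τ^d`. -/
theorem tendsto_expWeight (hDb : Bornology.IsBounded D) (hDo : IsOpen D) {P t δ : ℝ} (hP : 0 < P)
    (hδ : 0 < δ) {ρ : Space d} (h : ∀ x ∈ D, inner ℝ ρ x ≤ t - δ) :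
    Tendsto (fun τ : ℝ => τ ^ (d : ℝ) * expWeight D P t ρ τ) atTop (𝓝 0) := by
  have hlim := (tendsto_rpow_mul_exp_neg_mul_atTop_nhds_zero (d : ℝ) (P * δ)
    (by positivity)).mul_const (volume.real D)
  rw [zero_mul] at hlim
  refine squeeze_zero' ?_ ?_ hlim
  · filter_upwards [eventually_ge_atTop 0] with τ hτ
    exact mul_nonneg (by positivity) (expWeight_nonneg _ _ _ _ _)
  · filter_upwards [eventually_ge_atTop 0] with τ hτ
    rw [mul_assoc]
    gcongr
    have : expWeight D P t ρ τ ≤ ∫ x in D, Real.exp (-(P * δ) * τ) := by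
      refine setIntegral_mono_on (integrableOn_exp hDb hDo P t ρ τ)
        (integrableOn_const hDb.measure_lt_top.ne) hDo.measurableSet fun x hx => ?_
      refine Real.exp_le_exp.2 ?_
      have h1 := mul_le_mul_of_nonneg_left (h x hx) (by positivity : 0 ≤ P * τ)
      linarith
    refine this.trans_eq ?_
    rw [setIntegral_const, smul_eq_mul, mul_comm]

/-- The part of `D` beyond the hyperplane is open and nonempty, and the exponential is at least one
there, so for `τ ≥ 1` its volume is a positive lower bound. -/
theorem not_tendsto_expWeight (hDb : Bornology.IsBounded D) (hDo : IsOpen D) {P t : ℝ}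
    (hP : 0 < P) {ρ x₀ : Space d} (hx₀ : x₀ ∈ D) (ht : t < inner ℝ ρ x₀) :
    ¬ Tendsto (fun τ : ℝ => τ ^ (d : ℝ) * expWeight D P t ρ τ) atTop (𝓝 0) := by
  intro hlim
  let D' : Set (Space d) := D ∩ {x | t < inner ℝ ρ x}
  have hD'o : IsOpen D' :=
    hDo.inter (isOpen_lt continuous_const (continuous_const.inner continuous_id))
  have hpos : 0 < volume.real D' :=
    ENNReal.toReal_pos (hD'o.measure_pos volume ⟨x₀, hx₀, ht⟩).ne'
      (hDb.subset Set.inter_subset_left).measure_lt_top.ne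
  refine hpos.not_ge (ge_of_tendsto hlim ?_)
  filter_upwards [eventually_ge_atTop 1] with τ hτ
  have h1 : volume.real D' ≤ expWeight D P t ρ τ := by
    have e : volume.real D' = ∫ x in D', (1 : ℝ) := by simp
    have hi := integrableOn_exp hDb hDo P t ρ τ
    rw [e]
    refine le_trans ?_ (setIntegral_mono_set hi (ae_of_all _ fun x => (Real.exp_pos _).le)
      (LE.le.eventuallyLE (Set.inter_subset_left : D' ⊆ D)))
    refine setIntegral_mono_on
      (integrableOn_const (hDb.subset Set.inter_subset_left).measure_lt_top.ne)
      (hi.mono_set Set.inter_subset_left) hD'o.measurableSet fun x hx => ?_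
    refine Real.one_le_exp ?_
    have : t < inner ℝ ρ x := hx.2
    have h0 : 0 ≤ inner ℝ ρ x - t := by linarith
    positivity
  have h2 : 1 ≤ τ ^ (d : ℝ) := Real.one_le_rpow hτ (by positivity)
  calc volume.real D' ≤ 1 * expWeight D P t ρ τ := by rwa [one_mul]
    _ ≤ _ := by
      gcongr
      exact expWeight_nonneg _ _ _ _ _

/-! ### Separation and recovery of the convex hull -/

theorem exists_unit_orthogonal (hd : 2 ≤ d) (ρ : Space d) :
    ∃ ρ' : Space d, ‖ρ'‖ = 1 ∧ inner ℝ ρ ρ' = 0 := by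
  have hne : (ℝ ∙ ρ)ᗮ ≠ ⊥ := fun h => by
    have h1 := congrArg (fun S : Submodule ℝ (Space d) => Module.finrank ℝ S)
      (Submodule.orthogonal_eq_bot_iff.1 h)
    have h2 := finrank_span_le_card (R := ℝ) ({ρ} : Set (Space d))
    simp only [Set.toFinset_singleton, Finset.card_singleton] at h2
    simp only [finrank_top, finrank_euclideanSpace, Fintype.card_fin] at h1
    omega
  obtain ⟨v, hv, hv0⟩ := Submodule.exists_mem_ne_zero_of_ne_bot hne
  have hv' : inner ℝ ρ v = (0 : ℝ) := Submodule.mem_orthogonal_singleton_iff_inner_right.1 hv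
  refine ⟨(‖v‖⁻¹ : ℝ) • v, ?_, by rw [real_inner_smul_right, hv', mul_zero]⟩
  rw [norm_smul, norm_inv, norm_norm, inv_mul_cancel₀ (norm_ne_zero_iff.2 hv0)]

/-- Points outside the closed convex hull are strictly separated from `D` by a unit vector. -/
theorem exists_unit_separation (hd : 1 ≤ d) {x : Space d} (hx : x ∉ closure (convexHull ℝ D)) :
    ∃ (ρ : Space d) (t δ : ℝ), ‖ρ‖ = 1 ∧ 0 < δ ∧ (∀ y ∈ D, inner ℝ ρ y ≤ t - δ) ∧
      t < inner ℝ ρ x := by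
  rcases D.eq_empty_or_nonempty with rfl | ⟨y₀, hy₀⟩
  · exact ⟨EuclideanSpace.single ⟨0, hd⟩ 1, inner ℝ (EuclideanSpace.single ⟨0, hd⟩ 1) x - 1, 1,
      by simp, one_pos, by simp, by linarith⟩
  · obtain ⟨f, u, hfu, hux⟩ := geometric_hahn_banach_closed_point
      (convex_convexHull ℝ D).closure isClosed_closure hx
    let v : Space d := (InnerProductSpace.toDual ℝ (Space d)).symm f
    have hv : ∀ y, inner ℝ v y = f y := fun y => InnerProductSpace.toDual_symm_apply
    have hDf : ∀ y ∈ D, f y < u := fun y hy => hfu y (subset_closure (subset_convexHull ℝ D hy))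
    have hv0 : v ≠ 0 := fun h0 => by
      have h1 := hDf y₀ hy₀
      rw [← hv, h0, inner_zero_left] at h1
      rw [← hv, h0, inner_zero_left] at hux
      linarith
    have hvn : 0 < ‖v‖ := norm_pos_iff.2 hv0
    have hvi : 0 < ‖v‖⁻¹ := inv_pos.2 hvn
    -- The threshold lies midway between the Hahn-Banach level `u` and `f x`, leaving the margin `δ`
    -- on the side of `D`; all is rescaled to a unit normal.
    refine ⟨‖v‖⁻¹ • v, ‖v‖⁻¹ * ((u + f x) / 2), ‖v‖⁻¹ * ((f x - u) / 2), ?_,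
      mul_pos hvi (by linarith), fun y hy => ?_, ?_⟩
    · rw [norm_smul, norm_inv, norm_norm, inv_mul_cancel₀ hvn.ne']
    · rw [real_inner_smul_left, hv, ← mul_sub]
      exact mul_le_mul_of_nonneg_left (by linarith [hDf y hy]) hvi.le
    · rw [real_inner_smul_left, hv]
      exact mul_lt_mul_of_pos_left (by linarith) hvi

/-- The enclosure method finds the convex hull if the indicator function is comparable with
`τ ^ d` times the exponential weight of `D`. -/
theorem enclosure_eq_convexHull (hd : 2 ≤ d) {P : ℝ} (hP : 0 < P) (hDb : Bornology.IsBounded D)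
    (hDo : IsOpen D) {w : ℝ → ℝ}
    {Λ : BoundaryValues p Ω → StrongDual ℝ (BoundaryValues p Ω)} {s : ℝ} (hs : s ≠ 0)
    (hI : ∃ k K : ℝ, 0 < k ∧ ∀ (t τ : ℝ) (ρ ρ' : Space d), 0 < τ → ‖ρ‖ = 1 → ‖ρ'‖ = 1 →
      inner ℝ ρ ρ' = 0 →
      k * (τ ^ (d : ℝ) * expWeight D P t ρ τ) ≤ s * indicatorFunction p Ω w Λ t ρ ρ' τ ∧
        s * indicatorFunction p Ω w Λ t ρ ρ' τ ≤ K * (τ ^ (d : ℝ) * expWeight D P t ρ τ)) :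
    enclosure p Ω w Λ = convexHull ℝ D := by
  obtain ⟨k, K, hk, hkK⟩ := hI
  have hiff : ∀ (t : ℝ) (ρ ρ' : Space d), ‖ρ‖ = 1 → ‖ρ'‖ = 1 → inner ℝ ρ ρ' = 0 →
      (Tendsto (fun τ => indicatorFunction p Ω w Λ t ρ ρ' τ) atTop (𝓝 0) ↔
        Tendsto (fun τ : ℝ => τ ^ (d : ℝ) * expWeight D P t ρ τ) atTop (𝓝 0)) := by
    intro t ρ ρ' hρ hρ' hort
    have hA : ∀ᶠ τ : ℝ in atTop, 0 ≤ τ ^ (d : ℝ) * expWeight D P t ρ τ := by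
      filter_upwards [eventually_ge_atTop 0] with τ hτ
      exact mul_nonneg (by positivity) (expWeight_nonneg _ _ _ _ _)
    constructor
    · intro h
      have h1 := (h.const_mul s).const_mul k⁻¹
      simp only [mul_zero] at h1
      refine squeeze_zero' hA ?_ h1
      filter_upwards [eventually_gt_atTop 0] with τ hτ
      rw [← div_eq_inv_mul, le_div_iff₀' hk]
      exact (hkK t τ ρ ρ' hτ hρ hρ' hort).1
    · intro h
      have h1 := h.const_mul K
      rw [mul_zero] at h1
      have h2 : Tendsto (fun τ => s * indicatorFunction p Ω w Λ t ρ ρ' τ) atTop (𝓝 0) := by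
        refine squeeze_zero' ?_ ?_ h1
        · filter_upwards [eventually_gt_atTop 0, hA] with τ hτ hA
          exact (mul_nonneg hk.le hA).trans (hkK t τ ρ ρ' hτ hρ hρ' hort).1
        · filter_upwards [eventually_gt_atTop 0] with τ hτ
          exact (hkK t τ ρ ρ' hτ hρ hρ' hort).2
      simpa [hs] using h2.const_mul s⁻¹
  let S : Set (Space d) := {x | ∀ (ρ ρ' : Space d) (t : ℝ), ‖ρ‖ = 1 → ‖ρ'‖ = 1 →
    inner ℝ ρ ρ' = 0 →
    Tendsto (fun τ => indicatorFunction p Ω w Λ t ρ ρ' τ) atTop (𝓝 0) → inner ℝ ρ x ≤ t}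
  have hS : Convex ℝ S := by
    intro x hx y hy a b ha hb hab ρ ρ' t h1 h2 h3 h4
    rw [inner_add_right, real_inner_smul_right, real_inner_smul_right]
    have hx' := mul_le_mul_of_nonneg_left (hx ρ ρ' t h1 h2 h3 h4) ha
    have hy' := mul_le_mul_of_nonneg_left (hy ρ ρ' t h1 h2 h3 h4) hb
    calc _ ≤ a * t + b * t := add_le_add hx' hy'
      _ = t := by rw [← add_mul, hab, one_mul]
  have hDS : D ⊆ S := fun x hx ρ ρ' t h1 h2 h3 h4 => by
    by_contra! hlt
    exact not_tendsto_expWeight hDb hDo hP hx hlt ((hiff t ρ ρ' h1 h2 h3).1 h4)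
  -- A point outside the closed hull is cut off by a half-space that `D` enters with a margin, and
  -- for such half-spaces the indicator decays.
  have hSc : S ⊆ closure (convexHull ℝ D) := fun x hx => by
    by_contra hcon
    obtain ⟨ρ, t, δ, hρ, hδ, hD, hlt⟩ := exists_unit_separation (by omega) hcon
    obtain ⟨ρ', hρ', hort⟩ := exists_unit_orthogonal hd ρ
    exact hlt.not_ge (hx ρ ρ' t hρ hρ' hort
      ((hiff t ρ ρ' hρ hρ' hort).2 (tendsto_expWeight hDb hDo hP hδ hD)))
  have hopen : IsOpen (convexHull ℝ D) := hDo.convexHull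
  refine Set.Subset.antisymm ?_ (interior_maximal (convexHull_min hDS hS) hopen)
  -- A convex set with nonempty interior has the same interior as its closure; this excludes the
  -- empty set, which is handled separately.
  rcases D.eq_empty_or_nonempty with rfl | hne
  · refine (interior_subset : interior S ⊆ S).trans (hSc.trans ?_)
    simp
  · refine (interior_mono hSc).trans ?_
    rw [(convex_convexHull ℝ D).interior_closure_eq_interior_of_nonempty_interior]
    · exact interior_subset
    · rw [hopen.interior_eq]
      exact hne.convexHull

theorem exists_gap_bounds_of_pos (hd : 1 ≤ d) (hp₁ : 1 < p) (hp : p ≠ ⊤) (hΩo : IsOpen Ω)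
    (hΩ : Bornology.IsBounded Ω) (hDo : IsOpen D) (hDΩ : D ⊆ Ω)
    (hmeas : Measurable (inclusionConductivity D σD)) {c C : ℝ} (hc : 0 < c)
    (h : ∀ x ∈ D, c ≤ σD x ∧ σD x ≤ C) :
    ∃ k K : ℝ, 0 < k ∧ ∀ u : sobolev p Ω, IsMinimizer 1 u →
      k * (∫ x in D, ‖grad u x‖ ^ p.toReal)
          ≤ 1 * dnGap (inclusionConductivity D σD) (trace u) ∧
        1 * dnGap (inclusionConductivity D σD) (trace u)
          ≤ K * ∫ x in D, ‖grad u x‖ ^ p.toReal := by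
  have hP1 : 0 < p.toReal - 1 := sub_pos.2 (one_lt_toReal hp₁ hp)
  -- The lower constant is positive because `1 + c > 1` is raised to a negative power.
  refine ⟨(p.toReal - 1) * (1 - (1 + c) ^ (-1 / (p.toReal - 1))), C, ?_, fun u hu => ?_⟩
  · refine mul_pos hP1 (sub_pos.2 (Real.rpow_lt_one_of_one_lt_of_neg (by linarith) ?_))
    exact div_neg_of_neg_of_pos (by norm_num) hP1
  · rw [one_mul]
    exact dnGap_bounds hd hp₁ hp hΩo hΩ hDo hDΩ hmeas (by linarith : 0 < 1 + c) h hu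

theorem exists_gap_bounds_of_neg (hd : 1 ≤ d) (hp₁ : 1 < p) (hp : p ≠ ⊤) (hΩo : IsOpen Ω)
    (hΩ : Bornology.IsBounded Ω) (hDo : IsOpen D) (hDΩ : D ⊆ Ω)
    (hmeas : Measurable (inclusionConductivity D σD)) {c : ℝ} (hc : 0 < c)
    (h : ∀ x ∈ D, -1 + c ≤ σD x ∧ σD x ≤ -c) :
    ∃ k K : ℝ, 0 < k ∧ ∀ u : sobolev p Ω, IsMinimizer 1 u →
      k * (∫ x in D, ‖grad u x‖ ^ p.toReal)
          ≤ -1 * dnGap (inclusionConductivity D σD) (trace u) ∧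
        -1 * dnGap (inclusionConductivity D σD) (trace u)
          ≤ K * ∫ x in D, ‖grad u x‖ ^ p.toReal := by
  -- The sign change swaps the two bounds: the competitor estimate with `σ_D ≤ -c` now supplies the
  -- positive lower constant.
  refine ⟨c, -((p.toReal - 1) * (1 - (1 + (-1 + c)) ^ (-1 / (p.toReal - 1)))), hc,
    fun u hu => ?_⟩
  have := dnGap_bounds hd hp₁ hp hΩo hΩ hDo hDΩ hmeas (by linarith : 0 < 1 + (-1 + c)) h hu
  constructor
  · linarith [this.2]
  · linarith [this.1]

end Inclusion

end PCalderon

end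

/-! ### The main theorem -/

theorem mainTheorem2 {d : ℕ} (hd : 2 ≤ d) (p : ENNReal) [Fact (1 ≤ p)] (hp₁ : 1 < p) (hp : p ≠ ⊤)
    (Ω : Set (PCalderon.Space d)) (hΩ_open : IsOpen Ω) (hΩ_conn : IsConnected Ω)
    (hΩ_bdd : Bornology.IsBounded Ω)
    (D : Set (PCalderon.Space d)) (hD_open : IsOpen D) (hD_sub : D ⊆ Ω)
    (hD_lip : PCalderon.HasLipschitzBoundary D)
    (σD : PCalderon.Space d → ℝ)
    (hσ_meas : Measurable (PCalderon.inclusionConductivity D σD))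
    (hσ : (∃ c C : ℝ, 0 < c ∧ ∀ x ∈ D, c ≤ σD x ∧ σD x ≤ C) ∨
      (∃ c : ℝ, 0 < c ∧ ∀ x ∈ D, -1 + c ≤ σD x ∧ σD x ≤ -c)) :
    -- the Dirichlet-to-Neumann maps of `σ` and of the background conductivity are well defined
    PCalderon.IsDNMap (PCalderon.inclusionConductivity D σD)
        (PCalderon.dnMap p Ω (PCalderon.inclusionConductivity D σD)) ∧
      PCalderon.IsDNMap 1 (PCalderon.dnMap p Ω 1) ∧
      -- Wolff functions exist
      (∃ w : ℝ → ℝ, PCalderon.IsWolffFunction p.toReal w) ∧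
      ∀ w : ℝ → ℝ, PCalderon.IsWolffFunction p.toReal w →
        -- the convex hull of `D` is recovered from the Dirichlet-to-Neumann map
        PCalderon.enclosure p Ω w
            (PCalderon.dnMap p Ω (PCalderon.inclusionConductivity D σD)) = convexHull ℝ D ∧
        -- the sign of `σ_D` is recovered from the Dirichlet-to-Neumann map
        (D.Nonempty → ∀ (t τ : ℝ) (ρ ρ' : PCalderon.Space d),
          0 < τ → ‖ρ‖ = 1 → ‖ρ'‖ = 1 → inner ℝ ρ ρ' = 0 →
          ((∀ x ∈ D, 0 < σD x) ↔ 0 < PCalderon.indicatorFunction p Ω w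
            (PCalderon.dnMap p Ω (PCalderon.inclusionConductivity D σD)) t ρ ρ' τ) ∧
          ((∀ x ∈ D, σD x < 0) ↔ PCalderon.indicatorFunction p Ω w
            (PCalderon.dnMap p Ω (PCalderon.inclusionConductivity D σD)) t ρ ρ' τ < 0)) := by
  have hd₁ : 1 ≤ d := by omega
  have hP := PCalderon.one_lt_toReal hp₁ hp
  have hDb := hΩ_bdd.subset hD_sub
  have hdn := fun hσe : PCalderon.IsElliptic (PCalderon.inclusionConductivity D σD) =>
    PCalderon.isDNMap_dnMap (p := p) hd₁ hp₁ hp hΩ_open hΩ_bdd hσe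
  have hdn₁ := PCalderon.isDNMap_dnMap (p := p) hd₁ hp₁ hp hΩ_open hΩ_bdd
    (PCalderon.isElliptic_one (α := PCalderon.Space d))
  have hex := PCalderon.exists_isWolffFunction hP
  have hA : D.Nonempty → ∀ (t τ : ℝ) (ρ : PCalderon.Space d), 0 < τ →
      0 < τ ^ (d : ℝ) * PCalderon.expWeight D p.toReal t ρ τ := fun hne t τ ρ hτ =>
    mul_pos (Real.rpow_pos_of_pos hτ _) (PCalderon.expWeight_pos hDb hD_open hne _ _ _ _)
  rcases hσ with ⟨c, C, hc, h⟩ | ⟨c, hc, h⟩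
  · refine ⟨hdn (PCalderon.isElliptic_inclusionConductivity hσ_meas (by linarith) h), hdn₁, hex,
      fun w hw => ?_⟩
    have hI := PCalderon.exists_indicatorFunction_bounds hp₁ hp hΩ_open hΩ_bdd hD_open hD_sub
      (PCalderon.exists_gap_bounds_of_pos hd₁ hp₁ hp hΩ_open hΩ_bdd hD_open hD_sub hσ_meas hc h) hw
    refine ⟨PCalderon.enclosure_eq_convexHull hd (by linarith) hDb hD_open one_ne_zero hI,
      fun hne t τ ρ ρ' hτ hρ hρ' hort => ?_⟩
    obtain ⟨k, K, hk, hkK⟩ := hI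
    have hpos := (mul_pos hk (hA hne t τ ρ hτ)).trans_le (hkK t τ ρ ρ' hτ hρ hρ' hort).1
    rw [one_mul] at hpos
    obtain ⟨x, hx⟩ := hne
    -- The sign of `σ_D` is fixed by the case, so each equivalence has two true or two false sides;
    -- a point of `D` refutes the wrong sign.
    exact ⟨iff_of_true (fun y hy => hc.trans_le (h y hy).1) hpos,
      iff_of_false (fun hneg => by linarith [hneg x hx, (h x hx).1]) hpos.not_gt⟩
  · refine ⟨hdn (PCalderon.isElliptic_inclusionConductivity hσ_meas (by linarith) h), hdn₁, hex,
      fun w hw => ?_⟩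
    have hI := PCalderon.exists_indicatorFunction_bounds hp₁ hp hΩ_open hΩ_bdd hD_open hD_sub
      (PCalderon.exists_gap_bounds_of_neg hd₁ hp₁ hp hΩ_open hΩ_bdd hD_open hD_sub hσ_meas hc h) hw
    refine ⟨PCalderon.enclosure_eq_convexHull hd (by linarith) hDb hD_open
      (neg_ne_zero.2 one_ne_zero) hI, fun hne t τ ρ ρ' hτ hρ hρ' hort => ?_⟩
    obtain ⟨k, K, hk, hkK⟩ := hI
    have hpos := (mul_pos hk (hA hne t τ ρ hτ)).trans_le (hkK t τ ρ ρ' hτ hρ hρ' hort).1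
    have hneg := neg_pos.1 (by simpa only [neg_one_mul] using hpos)
    obtain ⟨x, hx⟩ := hne
    exact ⟨iff_of_false (fun hp => by linarith [hp x hx, (h x hx).2]) hneg.not_gt,
      iff_of_true (fun y hy => by linarith [(h y hy).2]) hneg⟩
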